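/- Let $L>0$, let $0=y_1<y_2<\dots<y_{r+1}=L$, and let the bending stiffness $EI$ be a function on $(0,L)$ that has a positive constant value on each segment $(y_j,y_{j+1})$, $j=1,\dots,r$ (its values at the points $y_j$ play no role). Let $0=x_1<x_2<\dots<x_{N+1}=L$ be a finite element partition with elements $K_k=[x_k,x_{k+1}]$ of length $h_k=x_{k+1}-x_k$, aligned with $EI$ in the sense that each $y_j$ equals some $x_k$. Let $$V=H^2_0(0,L)=\{v\in H^2(0,L): v(0)=v'(0)=v(L)=v'(L)=0\},\qquad V_h=\{v_h\in V: v_h|_{K_k}\text{ is a polynomial of degree at most }3\text{ for all }k\},$$ $$a(u,v)=\int_0^L EI\,u''v''\,dx,\qquad b(u,v)=\int_0^L u'v'\,dx .$$ Let $\kappa_k$ be the minimal value of $EI$ on (the interior of) $K_k$, that is, its constant value there, and let $$h_{EI}^2=\max_{k=1,\dots,N}\frac{h_k^2}{\kappa_k},\qquad C_h=\frac{h_{EI}}{2\pi}.$$ **Theorem.** The eigenvalues $P$ of the problem "$0\ne u\in V$, $a(u,v)=P\,b(u,v)$ for all $v\in V$" form an infinite sequence $P_1\le P_2\le\cdots$,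 and the eigenvalues of the problem "$0\ne u_h\in V_h$, $a(u_h,v_h)=P_h\,b(u_h,v_h)$ for all $v_h\in V_h$" form a finite sequence $P_{h,1}\le\dots\le P_{h,\dim V_h}$, each eigenvalue being listed as often as its multiplicity (the dimension of its eigenspace). They satisfy $$\frac{P_{h,i}}{1+P_{h,i}C_h^2}\le P_i\le P_{h,i}\qquad\text{for all } i=1,2,\dots,\dim V_h .$$ -/

import Mathlib

open Set MeasureTheory
open scoped ContDiff

noncomputable section

namespace BeamBuckling

/-- Test functions: the elements of `C_c^∞((0,L))`. -/
def IsTestFunction (L : ℝ) (φ : ℝ → ℝ) : Prop :=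
  ContDiff ℝ ∞ φ ∧ HasCompactSupport φ ∧ tsupport φ ⊆ Ioo 0 L

/-- `f ∈ L²(0,L)`. -/
def MemL2 (L : ℝ) (f : ℝ → ℝ) : Prop :=
  MemLp f 2 (volume.restrict (Ioo 0 L))

/-- `g` is a weak (generalized) derivative of `f` on `(0,L)`. -/
def HasWeakDeriv (L : ℝ) (f g : ℝ → ℝ) : Prop :=
  ∀ φ : ℝ → ℝ, IsTestFunction L φ →
    ∫ x in Ioo 0 L, f x * deriv φ x = - ∫ x in Ioo 0 L, g x * φ x

/-- The Sobolev space `H²(0,L)`, as a predicate on representatives. -/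
def MemH2 (L : ℝ) (u : ℝ → ℝ) : Prop :=
  MemL2 L u ∧ ∃ u₁ u₂ : ℝ → ℝ,
    MemL2 L u₁ ∧ MemL2 L u₂ ∧ HasWeakDeriv L u u₁ ∧ HasWeakDeriv L u₁ u₂

open Classical in
/-- A representative of the weak derivative of `f` in `L²(0,L)`, which is unique up to null sets
(and `0` if `f` has no weak derivative in `L²(0,L)`). -/
def weakDeriv (L : ℝ) (f : ℝ → ℝ) : ℝ → ℝ :=
  if h : ∃ g : ℝ → ℝ, MemL2 L g ∧ HasWeakDeriv L f g then h.choose else 0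

lemma MemL2.integrable_mul_test {L : ℝ} {f φ : ℝ → ℝ} (hf : MemL2 L f)
    (hφ : Continuous φ) (hc : HasCompactSupport φ) :
    Integrable (fun x => f x * φ x) (volume.restrict (Ioo 0 L)) := by
  have hf1 : Integrable f (volume.restrict (Ioo 0 L)) := MemLp.integrable (by norm_num) hf
  obtain ⟨C, hC⟩ := hφ.bounded_above_of_compact_support hc
  exact hf1.mul_bdd (c := C) hφ.aestronglyMeasurable (Filter.Eventually.of_forall hC)

lemma IsTestFunction.continuous_deriv {L : ℝ} {φ : ℝ → ℝ} (hφ : IsTestFunction L φ) :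
    Continuous (deriv φ) :=
  hφ.1.continuous_deriv (by simp)

lemma HasWeakDeriv.add {L : ℝ} {f g f' g' : ℝ → ℝ} (hf : MemL2 L f) (hg : MemL2 L g)
    (hf' : MemL2 L f') (hg' : MemL2 L g')
    (h1 : HasWeakDeriv L f f') (h2 : HasWeakDeriv L g g') :
    HasWeakDeriv L (f + g) (f' + g') := by
  intro φ hφ
  have e1 := h1 φ hφ
  have e2 := h2 φ hφ
  simp only [Pi.add_apply, add_mul]
  rw [integral_add (MemL2.integrable_mul_test hf hφ.continuous_deriv hφ.2.1.deriv)
      (MemL2.integrable_mul_test hg hφ.continuous_deriv hφ.2.1.deriv),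
    integral_add (MemL2.integrable_mul_test hf' hφ.1.continuous hφ.2.1)
      (MemL2.integrable_mul_test hg' hφ.1.continuous hφ.2.1), e1, e2]
  ring

lemma HasWeakDeriv.smul {L : ℝ} {f f' : ℝ → ℝ} (c : ℝ) (h : HasWeakDeriv L f f') :
    HasWeakDeriv L (c • f) (c • f') := by
  intro φ hφ
  have e := h φ hφ
  simp only [Pi.smul_apply, smul_eq_mul, mul_assoc]
  rw [integral_const_mul, integral_const_mul, e]
  ring

lemma MemH2.add {L : ℝ} {u v : ℝ → ℝ} (hu : MemH2 L u) (hv : MemH2 L v) : MemH2 L (u + v) := by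
  obtain ⟨h0, u₁, u₂, h1, h2, d1, d2⟩ := hu
  obtain ⟨k0, v₁, v₂, k1, k2, e1, e2⟩ := hv
  exact ⟨MemLp.add h0 k0, u₁ + v₁, u₂ + v₂, MemLp.add h1 k1, MemLp.add h2 k2,
    d1.add h0 k0 h1 k1 e1, d2.add h1 k1 h2 k2 e2⟩

lemma MemH2.smul {L : ℝ} {u : ℝ → ℝ} (c : ℝ) (hu : MemH2 L u) : MemH2 L (c • u) := by
  obtain ⟨h0, u₁, u₂, h1, h2, d1, d2⟩ := hu
  exact ⟨MemLp.const_smul h0 c, c • u₁, c • u₂, MemLp.const_smul h1 c, MemLp.const_smul h2 c,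
    d1.smul c, d2.smul c⟩

lemma MemH2.zero (L : ℝ) : MemH2 L 0 := by
  have h0 : MemL2 L 0 := MemLp.zero
  exact ⟨h0, 0, 0, h0, h0, fun φ _ => by simp, fun φ _ => by simp⟩

/-- The space `V = H²₀(0,L)` of all `v ∈ H²(0,L)` with `v(0) = v'(0) = v(L) = v'(L) = 0`.
An element is given by its representative in `C¹([0,L])`; to have exactly one function on `ℝ` for
each element, the representative is extended by zero outside `[0,L]`. -/
def V (L : ℝ) : Submodule ℝ (ℝ → ℝ) where
  carrier := {v | MemH2 L v ∧ ContDiffOn ℝ 1 v (Icc 0 L) ∧ (∀ x ∉ Icc 0 L, v x = 0) ∧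
    v 0 = 0 ∧ HasDerivWithinAt v 0 (Icc 0 L) 0 ∧ v L = 0 ∧ HasDerivWithinAt v 0 (Icc 0 L) L}
  zero_mem' := ⟨MemH2.zero L, contDiffOn_const, fun _ _ => rfl, rfl,
    hasDerivWithinAt_const _ _ _, rfl, hasDerivWithinAt_const _ _ _⟩
  add_mem' := by
    rintro u v ⟨u0, u1, u2, u3, u4, u5, u6⟩ ⟨v0, v1, v2, v3, v4, v5, v6⟩
    exact ⟨u0.add v0, u1.add v1, fun x hx => by simp [u2 x hx, v2 x hx], by simp [u3, v3],
      by simpa using u4.add v4, by simp [u5, v5], by simpa using u6.add v6⟩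
  smul_mem' := by
    rintro c u ⟨u0, u1, u2, u3, u4, u5, u6⟩
    exact ⟨u0.smul c, u1.const_smul c, fun x hx => by simp [u2 x hx], by simp [u3],
      by simpa using u4.const_smul c, by simp [u5], by simpa using u6.const_smul c⟩

/-- `a(u,v) = ∫₀ᴸ EI u'' v''`. -/
def formA (L : ℝ) (EI u v : ℝ → ℝ) : ℝ :=
  ∫ x in Ioo 0 L, EI x * weakDeriv L (weakDeriv L u) x * weakDeriv L (weakDeriv L v) x

/-- `b(u,v) = ∫₀ᴸ u' v'`. -/
def formB (L : ℝ) (u v : ℝ → ℝ) : ℝ :=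
  ∫ x in Ioo 0 L, weakDeriv L u x * weakDeriv L v x

/-- A partition `0 = x₀ < x₁ < ⋯ < x_N = L` of `[0,L]` into `N` pieces. -/
structure Partition (L : ℝ) (N : ℕ) where
  node : Fin (N + 1) → ℝ
  strictMono : StrictMono node
  node_zero : node 0 = 0
  node_last : node (Fin.last N) = L

/-- The cubic Hermite finite element space: all `v ∈ V` that are a polynomial of degree at most
three on every element. -/
def Vh {L : ℝ} {N : ℕ} (x : Partition L N) : Submodule ℝ (ℝ → ℝ) where
  carrier := {v | v ∈ V L ∧ ∀ k : Fin N, ∃ p : Polynomial ℝ, p.natDegree ≤ 3 ∧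
    ∀ t ∈ Icc (x.node k.castSucc) (x.node k.succ), v t = p.eval t}
  zero_mem' := ⟨(V L).zero_mem, fun _ => ⟨0, by simp, fun _ _ => by simp⟩⟩
  add_mem' := by
    rintro u v ⟨hu, hu'⟩ ⟨hv, hv'⟩
    refine ⟨(V L).add_mem hu hv, fun k => ?_⟩
    obtain ⟨p, hp, hpe⟩ := hu' k
    obtain ⟨q, hq, hqe⟩ := hv' k
    exact ⟨p + q, Polynomial.natDegree_add_le_of_degree_le hp hq,
      fun t ht => by simp [hpe t ht, hqe t ht]⟩
  smul_mem' := by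
    rintro c u ⟨hu, hu'⟩
    refine ⟨(V L).smul_mem c hu, fun k => ?_⟩
    obtain ⟨p, hp, hpe⟩ := hu' k
    exact ⟨c • p, (Polynomial.natDegree_smul_le c p).trans hp,
      fun t ht => by simp [hpe t ht]⟩

/-- `u` is an eigenfunction for the eigenvalue `P` of the weak problem posed on the space `W`:
`u ∈ W` is nonzero and `a(u,v) = P b(u,v)` for all `v ∈ W`. -/
def IsEigenfunction (L : ℝ) (EI : ℝ → ℝ) (W : Submodule ℝ (ℝ → ℝ)) (P : ℝ) (u : ℝ → ℝ) : Prop :=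
  u ∈ W ∧ u ≠ 0 ∧ ∀ v ∈ W, formA L EI u v = P * formB L u v

/-- The eigenspace of `P`. (The eigenfunctions together with `0` already form a linear space
when `EI` is bounded and measurable, so that taking the span adds nothing.) -/
def eigenspace (L : ℝ) (EI : ℝ → ℝ) (W : Submodule ℝ (ℝ → ℝ)) (P : ℝ) :
    Submodule ℝ (ℝ → ℝ) :=
  Submodule.span ℝ {u | IsEigenfunction L EI W P u}

/-- `P` lists all eigenvalues of the weak problem posed on `W` in nondecreasing order, each as
often as its multiplicity says: a real number `c` occurs in the list exactly `dim (eigenspace c)`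
times (so not at all, if it is not an eigenvalue). -/
def IsEigenvalueEnumeration {ι : Type} [Preorder ι] (L : ℝ) (EI : ℝ → ℝ)
    (W : Submodule ℝ (ℝ → ℝ)) (P : ι → ℝ) : Prop :=
  Monotone P ∧ ∀ c : ℝ, Cardinal.mk {i : ι // P i = c} = Module.rank ℝ (eigenspace L EI W c)

/-- `EI` has a positive constant value on each open segment of the partition `y`. -/
def IsPiecewiseConstant {L : ℝ} {r : ℕ} (y : Partition L r) (EI : ℝ → ℝ) : Prop :=
  ∀ j : Fin r, ∃ c : ℝ, 0 < c ∧ ∀ t ∈ Ioo (y.node j.castSucc) (y.node j.succ), EI t = c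

/-- The finite element partition `x` is aligned with `y`: each node of `y` is a node of `x`. -/
def IsAligned {L : ℝ} {N r : ℕ} (x : Partition L N) (y : Partition L r) : Prop :=
  ∀ j : Fin (r + 1), ∃ k : Fin (N + 1), y.node j = x.node k

/-- Length `h_k` of the element `K_k`. -/
def Partition.len {L : ℝ} {N : ℕ} (x : Partition L N) (k : Fin N) : ℝ :=
  x.node k.succ - x.node k.castSucc

/-- The minimal value `κ_k` of `EI` over the element `K_k`. It is taken over the interior of the
element, because a piecewise constant `EI` has no prescribed value at its jumps. -/
def kappa {L : ℝ} {N : ℕ} (x : Partition L N) (EI : ℝ → ℝ) (k : Fin N) : ℝ :=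
  sInf (EI '' Ioo (x.node k.castSucc) (x.node k.succ))

/-- The scaled mesh size `h_EI`, where `h_EI² = max_k h_k² / κ_k`. -/
def hEI {L : ℝ} {N : ℕ} (x : Partition L N) (EI : ℝ → ℝ) : ℝ :=
  Real.sqrt (⨆ k : Fin N, x.len k ^ 2 / kappa x EI k)

/-- `C_h = h_EI / (2π)`. -/
def Ch {L : ℝ} {N : ℕ} (x : Partition L N) (EI : ℝ → ℝ) : ℝ :=
  hEI x EI / (2 * Real.pi)

end BeamBuckling

end

open Set MeasureTheory
open scoped ContDiff

noncomputable section

namespace BeamBuckling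

open scoped InnerProductSpace
open Filter Topology

/-! ### Variational spectral theory of a compact injective operator on a subspace. -/

section Spectral

variable {G : Type} [NormedAddCommGroup G] [InnerProductSpace ℝ G]

/-! The substitution `g = √EI · u''` turns the problem into one in `L²(0,L)`. With `s = EI^(-1/2)`,
`u` is the second primitive of `g s`, so `a(u,v)` becomes the plain inner product
(`formA_deflection`) and `b(u,v)` becomes `⟪J g, J k⟫`, where `J` is `slope`, the integral operator
`g ↦ ∫₀ˣ g s` (`formB_deflection`). The space `V` corresponds to the closed subspace `clamped` of
finite codimension (`map_clamped`), and `V_h` to a finite-dimensional subspace of it.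

Since `J` is compact (`isCompactOperator_slope`) and injective, successive maximization of `‖J v‖`
over unit spheres yields complete systems of eigenpairs on both subspaces
(`exists_isEigensystem_nat`, `exists_isEigensystem_fin`). The multiplicities determine the ordered
lists, so any enumeration agrees with the constructed one (`eq_of_monotone_of_card_fiber_eq`).

The upper bound is the min-max principle. For the lower bound, some nonzero combination `v` of the
first exact eigenvectors, up to index `i`, has a projection `π v` to the discrete space orthogonal
to the discrete eigenvectors of index below `i`. Hence `P_{h,i} ‖J π v‖² ≤ ‖π v‖²`, while the
remainder obeys `‖J (v - π v)‖ ≤ C_h ‖v - π v‖`; Cauchy-Schwarz combines the two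
(`eigenvalue_bounds`).

The sharp `C_h` comes from one dimension. A clamped `w` orthogonal to the discrete space is
orthogonal to all piecewise affine functions, because `EI` is constant on elements. So the
corresponding deflection and its derivative vanish at every node
(`primitives_eq_zero_of_mem_orthogonal`). On each element the derivative is therefore periodic with
mean zero, and `wirtinger` gives the factor `h_k / (2π)`, as used in
`norm_slope_le_of_mem_orthogonal`. -/

lemma exists_ne_zero_map_eq_zero {E : Type*} [AddCommGroup E] [Module ℝ E] {n : ℕ}
    (f : E →ₗ[ℝ] (Fin n → ℝ)) (h : FiniteDimensional ℝ E → n < Module.finrank ℝ E) :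
    ∃ v, v ≠ 0 ∧ f v = 0 := by
  by_contra! hcon
  have hinj : Function.Injective f := by
    rw [← LinearMap.ker_eq_bot, LinearMap.ker_eq_bot']
    intro v hv
    by_contra h0
    exact hcon v h0 hv
  have hfd : FiniteDimensional ℝ E := FiniteDimensional.of_injective f hinj
  have := LinearMap.finrank_le_finrank_of_injective hinj
  simp only [Module.finrank_fin_fun] at this
  exact absurd (h hfd) (by omega)

/-- The discriminant is `4 b²`, which must be nonpositive. This is the first-order condition at a
maximizer, in a form that needs no derivative. -/
lemma eq_zero_of_forall_quadratic_nonneg {b c : ℝ} (h : ∀ t : ℝ, 0 ≤ 2 * b * t + c * t ^ 2) :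
    b = 0 := by
  have := discrim_le_zero (a := c) (b := 2 * b) (c := 0) (fun t => by nlinarith [h t])
  unfold discrim at this
  nlinarith [sq_nonneg b]

/-- A compact operator attains its norm on the unit sphere of a nonzero closed subspace. -/
lemma exists_maximizer [CompleteSpace G] {J : G →L[ℝ] G} (hJ : IsCompactOperator J)
    (hinj : ∀ v, J v = 0 → v = 0) (K : Submodule ℝ G) (hK : IsClosed (K : Set G))
    (hne : ∃ v ∈ K, v ≠ 0) :
    ∃ v ∈ K, ‖v‖ = 1 ∧ ∀ w ∈ K, ‖J w‖ ≤ ‖J v‖ * ‖w‖ := by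
  set S : Set ℝ := (fun v => ‖J v‖) '' {v : G | v ∈ K ∧ ‖v‖ ≤ 1} with hS
  have hbdd : BddAbove S := by
    refine ⟨‖J‖, ?_⟩
    rintro _ ⟨v, ⟨-, hv⟩, rfl⟩
    exact (J.le_opNorm v).trans (mul_le_of_le_one_right (norm_nonneg _) hv)
  have hSne : S.Nonempty := ⟨_, 0, ⟨K.zero_mem, by simp⟩, rfl⟩
  set m := sSup S with hm
  have hle : ∀ w ∈ K, ‖J w‖ ≤ m * ‖w‖ := by
    intro w hw
    rcases eq_or_ne w 0 with rfl | h0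
    · simp
    · have hn : 0 < ‖w‖ := norm_pos_iff.mpr h0
      have : ‖J (‖w‖⁻¹ • w)‖ ≤ m :=
        le_csSup hbdd ⟨_, ⟨K.smul_mem _ hw, by
          rw [norm_smul, norm_inv, norm_norm, inv_mul_cancel₀ hn.ne']⟩, rfl⟩
      rw [map_smul, norm_smul, norm_inv, norm_norm, inv_mul_le_iff₀ hn] at this
      linarith
  have hmpos : 0 < m := by
    obtain ⟨v, hv, h0⟩ := hne
    have h1 : 0 < ‖J v‖ := norm_pos_iff.mpr fun h => h0 (hinj v h)
    have h2 := hle v hv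
    have h3 : 0 < ‖v‖ := norm_pos_iff.mpr h0
    by_contra hneg
    nlinarith
  obtain ⟨s, -, hs, hsS⟩ := exists_seq_tendsto_sSup hSne hbdd
  choose v hv hvs using hsS
  have hcpt := hJ.isCompact_closure_image_closedBall (f := (J : G →ₗ[ℝ] G)) 1
  obtain ⟨y, -, φ, hφ, hy⟩ := hcpt.tendsto_subseq (x := fun n => J (v n))
    (fun n => subset_closure ⟨v n, by simpa using (hv n).2, rfl⟩)
  have hym : ‖y‖ = m := by
    have h1 : Tendsto (fun n => ‖J (v (φ n))‖) atTop (𝓝 ‖y‖) := hy.norm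
    have h2 : Tendsto (fun n => ‖J (v (φ n))‖) atTop (𝓝 m) := by
      have := hs.comp hφ.tendsto_atTop
      refine this.congr fun n => ?_
      exact (hvs (φ n)).symm
    exact tendsto_nhds_unique h1 h2
  -- Compactness only makes the images converge. Two images close to `y` with `‖y‖ = m` force `‖v +
  -- v'‖` close to `2`, and the parallelogram law then makes `‖v - v'‖` small.
  have hcau : CauchySeq (fun n => v (φ n)) := by
    rw [Metric.cauchySeq_iff']
    intro ε hε
    obtain ⟨δ, hδ, hδ'⟩ : ∃ δ : ℝ, 0 < δ ∧ 8 * δ / m ≤ ε ^ 2 / 2 :=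
      ⟨ε ^ 2 * m / 16, by positivity, by field_simp; norm_num⟩
    have hev := (Metric.tendsto_atTop.mp hy) δ hδ
    obtain ⟨n₀, hn₀⟩ := hev
    refine ⟨n₀, fun n hn => ?_⟩
    have e1 := hn₀ n hn
    have e2 := hn₀ n₀ le_rfl
    rw [dist_eq_norm] at e1 e2 ⊢
    simp only [Function.comp] at e1 e2
    have hsum : 2 * m - 2 * δ ≤ ‖J (v (φ n) + v (φ n₀))‖ := by
      have : (2 : ℝ) • y = J (v (φ n) + v (φ n₀)) - (J (v (φ n)) - y) - (J (v (φ n₀)) - y) := by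
        rw [map_add, two_smul]; abel
      have h3 : ‖(2 : ℝ) • y‖ = 2 * m := by rw [norm_smul, hym]; simp
      have h4 := norm_sub_le (J (v (φ n) + v (φ n₀)) - (J (v (φ n)) - y)) (J (v (φ n₀)) - y)
      have h5 := norm_sub_le (J (v (φ n) + v (φ n₀))) (J (v (φ n)) - y)
      rw [← this, h3] at h4
      linarith
    have hsum2 : 2 - 2 * δ / m ≤ ‖v (φ n) + v (φ n₀)‖ := by
      have := hle _ (K.add_mem (hv (φ n)).1 (hv (φ n₀)).1)
      have h6 : (2 - 2 * δ / m) * m = 2 * m - 2 * δ := by field_simp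
      by_contra hlt
      push Not at hlt
      nlinarith
    have hpar := parallelogram_law_with_norm ℝ (v (φ n)) (v (φ n₀))
    have b1 := (hv (φ n)).2
    have b2 := (hv (φ n₀)).2
    have hb : ‖v (φ n) - v (φ n₀)‖ ^ 2 ≤ 8 * δ / m := by
      have c1 : ‖v (φ n)‖ * ‖v (φ n)‖ ≤ 1 := mul_le_one₀ b1 (norm_nonneg _) b1
      have c2 : ‖v (φ n₀)‖ * ‖v (φ n₀)‖ ≤ 1 := mul_le_one₀ b2 (norm_nonneg _) b2
      have c3 : 8 * δ / m = 4 * (2 * δ / m) := by ring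
      have c4 : 0 ≤ ‖v (φ n) + v (φ n₀)‖ := norm_nonneg _
      have c5 : 4 - 4 * (2 * δ / m) ≤ ‖v (φ n) + v (φ n₀)‖ * ‖v (φ n) + v (φ n₀)‖ := by
        rcases le_total (2 - 2 * δ / m) 0 with h | h
        · nlinarith
        · nlinarith
      nlinarith
    have : ‖v (φ n) - v (φ n₀)‖ ^ 2 < ε ^ 2 := by nlinarith [sq_pos_of_pos hε]
    exact lt_of_pow_lt_pow_left₀ 2 hε.le this
  obtain ⟨z, hz⟩ := cauchySeq_tendsto_of_complete hcau
  have hzK : z ∈ K := hK.mem_of_tendsto hz (Eventually.of_forall fun n => (hv (φ n)).1)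
  have hz1 : ‖z‖ ≤ 1 := le_of_tendsto hz.norm (Eventually.of_forall fun n => (hv (φ n)).2)
  have hJz : J z = y := tendsto_nhds_unique ((J.continuous.tendsto z).comp hz) hy
  have hz2 : ‖z‖ = 1 := by
    refine le_antisymm hz1 ?_
    have := hle z hzK
    rw [hJz, hym] at this
    by_contra hlt
    push Not at hlt
    nlinarith
  exact ⟨z, hzK, hz2, fun w hw => by rw [hJz, hym]; exact hle w hw⟩

/-- The Euler-Lagrange equation: comparison of `v` with `v + t • w` for all real `t` gives a
nonnegative quadratic without constant term, so its linear coefficient vanishes. -/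
lemma inner_eq_of_maximizer {J : G →L[ℝ] G} {K : Submodule ℝ G} {v : G} (hv : v ∈ K)
    (h1 : ‖v‖ = 1) (hmax : ∀ w ∈ K, ‖J w‖ ≤ ‖J v‖ * ‖w‖) {w : G} (hw : w ∈ K) :
    ⟪J v, J w⟫_ℝ = ‖J v‖ ^ 2 * ⟪v, w⟫_ℝ := by
  have key : ∀ t : ℝ, 0 ≤ 2 * (‖J v‖ ^ 2 * ⟪v, w⟫_ℝ - ⟪J v, J w⟫_ℝ) * t +
      (‖J v‖ ^ 2 * ‖w‖ ^ 2 - ‖J w‖ ^ 2) * t ^ 2 := by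
    intro t
    have h2 := hmax _ (K.add_mem hv (K.smul_mem t hw))
    have h3 : ‖J (v + t • w)‖ ^ 2 ≤ ‖J v‖ ^ 2 * ‖v + t • w‖ ^ 2 := by
      rw [← mul_pow]; exact pow_le_pow_left₀ (norm_nonneg _) h2 2
    rw [map_add, map_smul, norm_add_sq_real, norm_add_sq_real, inner_smul_right, inner_smul_right,
      norm_smul, norm_smul, h1, mul_pow, mul_pow, Real.norm_eq_abs, sq_abs] at h3
    nlinarith
  linarith [eq_zero_of_forall_quadratic_nonneg key]

/-- `(P, u)` is a complete system of eigenpairs on `K` for the problem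
`⟪u, v⟫ = P ⟪J u, J v⟫` for all `v ∈ K`, in nondecreasing order. -/
structure IsEigensystem (J : G →L[ℝ] G) (K : Submodule ℝ G) {ι : Type} [LinearOrder ι]
    (P : ι → ℝ) (u : ι → G) : Prop where
  mem : ∀ i, u i ∈ K
  orthonormal : Orthonormal ℝ u
  eig : ∀ i, ∀ v ∈ K, ⟪u i, v⟫_ℝ = P i * ⟪J (u i), J v⟫_ℝ
  mono : Monotone P
  minimal : ∀ i, ∀ v ∈ K, (∀ j < i, ⟪u j, v⟫_ℝ = 0) → P i * ‖J v‖ ^ 2 ≤ ‖v‖ ^ 2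
  complete : ∀ v ∈ K, (∀ j, ⟪u j, v⟫_ℝ = 0) → v = 0
  finite_fiber : ∀ c, {i | P i = c}.Finite

/-- The vectors of `K` orthogonal to a set. -/
def orthIn (K : Submodule ℝ G) (A : Set G) : Submodule ℝ G := K ⊓ (Submodule.span ℝ A)ᗮ

lemma mem_orthIn {K : Submodule ℝ G} {A : Set G} {v : G} :
    v ∈ orthIn K A ↔ v ∈ K ∧ ∀ a ∈ A, ⟪a, v⟫_ℝ = 0 := by
  refine and_congr_right fun _ => ?_
  constructor
  · exact fun h a ha => h a (Submodule.subset_span ha)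
  · intro h a ha
    induction ha using Submodule.span_induction with
    | mem x hx => exact h x hx
    | zero => simp
    | add x y _ _ hx hy => rw [inner_add_left, hx, hy, add_zero]
    | smul c x _ hx => rw [inner_smul_left, hx, mul_zero]

/-- Successive maximization of `‖J v‖` over the unit spheres of orthogonal complements. -/
lemma exists_greedy_sequence [CompleteSpace G] {J : G →L[ℝ] G} (hJ : IsCompactOperator J)
    (hinj : ∀ v, J v = 0 → v = 0) (K : Submodule ℝ G) (hK : IsClosed (K : Set G)) :
    ∃ u : ℕ → G, ∀ n, (∃ v ∈ orthIn K (u '' Iio n), v ≠ 0) →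
      u n ∈ orthIn K (u '' Iio n) ∧ ‖u n‖ = 1 ∧
        ∀ w ∈ orthIn K (u '' Iio n), ‖J w‖ ≤ ‖J (u n)‖ * ‖w‖ := by
  have hstep : ∀ A : Set G, ∃ z, (∃ v ∈ orthIn K A, v ≠ 0) → z ∈ orthIn K A ∧ ‖z‖ = 1 ∧
      ∀ w ∈ orthIn K A, ‖J w‖ ≤ ‖J z‖ * ‖w‖ := by
    intro A
    by_cases h : ∃ v ∈ orthIn K A, v ≠ 0
    · have hcl : IsClosed (orthIn K A : Set G) :=
        hK.inter (Submodule.isClosed_orthogonal _)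
      obtain ⟨z, h1, h2, h3⟩ := exists_maximizer hJ hinj _ hcl h
      exact ⟨z, fun _ => ⟨h1, h2, h3⟩⟩
    · exact ⟨0, fun h' => absurd h' h⟩
  choose next hnext using hstep
  -- Recursion on the set of vectors already chosen, rather than on the sequence, avoids strong
  -- recursion; `hs` below identifies `s n` with the image of `Iio n`.
  let s : ℕ → Set G := fun n => Nat.rec ∅ (fun _ A => insert (next A) A) n
  refine ⟨fun n => next (s n), fun n => ?_⟩
  have hs : ∀ n, (fun n => next (s n)) '' Iio n = s n := by
    intro n
    induction n with
    | zero => simp [s]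
    | succ k ih =>
      have : Iio (k + 1) = insert k (Iio k) := by ext j; simp
      rw [this, image_insert_eq, ih]
  rw [hs]
  exact hnext (s n)

/-- The greedy sequence yields eigenpairs as long as it does not terminate. -/
lemma greedy_eig {J : G →L[ℝ] G} {K : Submodule ℝ G} {u : ℕ → G} {d : ℕ → Prop}
    (hd : ∀ i j, i ≤ j → d j → d i)
    (hu : ∀ n, d n → u n ∈ orthIn K (u '' Iio n) ∧ ‖u n‖ = 1 ∧
        ∀ w ∈ orthIn K (u '' Iio n), ‖J w‖ ≤ ‖J (u n)‖ * ‖w‖) :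
    (∀ i j, d j → i < j → ⟪u i, u j⟫_ℝ = 0) ∧
    (∀ n, d n → ∀ v ∈ K, ⟪J (u n), J v⟫_ℝ = ‖J (u n)‖ ^ 2 * ⟪u n, v⟫_ℝ) := by
  have horth : ∀ i j, d j → i < j → ⟪u i, u j⟫_ℝ = 0 := fun i j hj hij =>
    (mem_orthIn.mp (hu j hj).1).2 _ ⟨i, hij, rfl⟩
  have hmem : ∀ n, d n → u n ∈ K := fun n hn => (mem_orthIn.mp (hu n hn).1).1
  refine ⟨horth, fun n hn v hv => ?_⟩
  have hloc : ∀ n, d n → ∀ w ∈ orthIn K (u '' Iio n),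
      ⟪J (u n), J w⟫_ℝ = ‖J (u n)‖ ^ 2 * ⟪u n, w⟫_ℝ := fun n hn w hw =>
    inner_eq_of_maximizer (hu n hn).1 (hu n hn).2.1 (hu n hn).2.2 hw
  -- The later vector `u n` is an admissible test vector in the maximization that produced `u j`.
  have hJorth : ∀ j < n, ⟪J (u n), J (u j)⟫_ℝ = 0 := by
    intro j hj
    have hdj := hd j n hj.le hn
    have : u n ∈ orthIn K (u '' Iio j) := by
      rw [mem_orthIn]
      refine ⟨hmem n hn, ?_⟩
      rintro _ ⟨i, hi, rfl⟩
      exact horth i n hn (lt_trans hi hj)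
    rw [real_inner_comm, hloc j hdj _ this, horth j n hn hj, mul_zero]
  -- Stationarity is known only for test vectors orthogonal to the earlier `u j`. Splitting off the
  -- component `p` along these extends it to all of `K`, as `p` contributes zero to both sides.
  set p := ∑ j ∈ Finset.range n, ⟪u j, v⟫_ℝ • u j with hp
  have hpK : p ∈ K := K.sum_mem fun j hj =>
    K.smul_mem _ (hmem j (hd j n (Finset.mem_range.mp hj).le hn))
  have hw : v - p ∈ orthIn K (u '' Iio n) := by
    rw [mem_orthIn]
    refine ⟨K.sub_mem hv hpK, ?_⟩
    rintro _ ⟨i, hi, rfl⟩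
    have hi' : i < n := hi
    rw [inner_sub_right, hp, inner_sum, Finset.sum_eq_single i]
    · rw [inner_smul_right, real_inner_self_eq_norm_sq, (hu i (hd i n hi'.le hn)).2.1]; ring
    · intro j hj hji
      rw [inner_smul_right]
      rcases lt_or_gt_of_ne hji with h | h
      · rw [real_inner_comm (u j) (u i), horth j i (hd i n hi'.le hn) h, mul_zero]
      · rw [horth i j (hd j n (Finset.mem_range.mp hj).le hn) h, mul_zero]
    · intro h; exact absurd (Finset.mem_range.mpr hi') h
  have e1 := hloc n hn _ hw
  have e2 : ⟪J (u n), J p⟫_ℝ = 0 := by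
    rw [hp, map_sum, inner_sum]
    refine Finset.sum_eq_zero fun j hj => ?_
    rw [map_smul, inner_smul_right, hJorth j (Finset.mem_range.mp hj), mul_zero]
  have e3 : ⟪u n, p⟫_ℝ = 0 := by
    rw [hp, inner_sum]
    refine Finset.sum_eq_zero fun j hj => ?_
    rw [inner_smul_right, real_inner_comm (u j) (u n), horth j n hn (Finset.mem_range.mp hj), mul_zero]
  rw [map_sub, inner_sub_right, inner_sub_right, e2, e3, sub_zero, sub_zero] at e1
  exact e1

lemma exists_mem_orthIn_ne_zero {K : Submodule ℝ G} {n : ℕ}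
    (h : FiniteDimensional ℝ K → n < Module.finrank ℝ K) (u : ℕ → G) :
    ∃ v ∈ orthIn K (u '' Iio n), v ≠ 0 := by
  obtain ⟨v, h0, hv⟩ := exists_ne_zero_map_eq_zero
    (LinearMap.pi fun j : Fin n => (innerSL ℝ (u j) : G →ₗ[ℝ] ℝ) ∘ₗ K.subtype) h
  refine ⟨v, mem_orthIn.mpr ⟨v.2, ?_⟩, by simpa using h0⟩
  rintro _ ⟨j, hj, rfl⟩
  exact congr_fun hv ⟨j, hj⟩

/-- The embedding `e` onto an initial segment of `ℕ` serves the infinite and the terminating case at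
once. An eigenvalue is the inverse square of the maximum reached, so a lower bound on these maxima
that fails for all but finitely many indices gives finite multiplicities. -/
lemma isEigensystem_of_greedy {J : G →L[ℝ] G} (hinj : ∀ v, J v = 0 → v = 0)
    {K : Submodule ℝ G} {u : ℕ → G} {ι : Type} [LinearOrder ι] (e : ι ↪o ℕ)
    (he : ∀ i j, i ≤ j → j ∈ range e → i ∈ range e)
    (hu : ∀ n ∈ range e, u n ∈ orthIn K (u '' Iio n) ∧ ‖u n‖ = 1 ∧
        ∀ w ∈ orthIn K (u '' Iio n), ‖J w‖ ≤ ‖J (u n)‖ * ‖w‖)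
    (hcomplete : ∀ v ∈ K, (∀ j, ⟪u (e j), v⟫_ℝ = 0) → v = 0)
    (hfin : ∀ δ > 0, {i : ι | δ ≤ ‖J (u (e i))‖}.Finite) :
    IsEigensystem J K (fun i => (‖J (u (e i))‖ ^ 2)⁻¹) (fun i => u (e i)) := by
  obtain ⟨horth, heig⟩ := greedy_eig (d := fun n => n ∈ range e) he hu
  have hn : ∀ i, ‖u (e i)‖ = 1 := fun i => (hu _ ⟨i, rfl⟩).2.1
  have hpos : ∀ i, 0 < ‖J (u (e i))‖ := fun i => norm_pos_iff.mpr fun h => by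
    have := hn i
    rw [hinj _ h] at this
    simp at this
  have hsub : ∀ i, ∀ v ∈ K, (∀ j < i, ⟪u (e j), v⟫_ℝ = 0) → v ∈ orthIn K (u '' Iio (e i)) := by
    intro i v hv h
    refine mem_orthIn.mpr ⟨hv, ?_⟩
    rintro _ ⟨j, hj, rfl⟩
    obtain ⟨k, rfl⟩ := he j (e i) (le_of_lt hj) ⟨i, rfl⟩
    exact h k (e.lt_iff_lt.mp hj)
  refine ⟨fun i => (mem_orthIn.mp (hu _ ⟨i, rfl⟩).1).1, ⟨hn, fun i j hij => ?_⟩,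
    fun i v hv => ?_, fun i j hij => ?_, fun i v hv h => ?_, hcomplete, fun c => ?_⟩
  · rcases lt_or_gt_of_ne hij with h | h
    · exact horth _ _ ⟨j, rfl⟩ (e.lt_iff_lt.mpr h)
    · change ⟪u (e i), u (e j)⟫_ℝ = 0
      rw [real_inner_comm]; exact horth _ _ ⟨i, rfl⟩ (e.lt_iff_lt.mpr h)
  · rw [heig _ ⟨i, rfl⟩ v hv, inv_mul_cancel_left₀ (by have := hpos i; positivity)]
  · have := (hu _ ⟨i, rfl⟩).2.2 (u (e j)) (hsub i _ (mem_orthIn.mp (hu _ ⟨j, rfl⟩).1).1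
      fun k hk => horth _ _ ⟨j, rfl⟩ (e.lt_iff_lt.mpr (hk.trans_le hij)))
    rw [hn, mul_one] at this
    have := hpos j
    exact inv_anti₀ (by positivity) (by gcongr)
  · have h2 := (hu _ ⟨i, rfl⟩).2.2 v (hsub i v hv h)
    have h3 := pow_le_pow_left₀ (norm_nonneg _) h2 2
    have := hpos i
    rw [inv_mul_le_iff₀ (by positivity), ← mul_pow]
    exact h3
  · rcases le_or_gt c 0 with hc | hc
    · convert Set.finite_empty
      ext i
      have := hpos i
      have : 0 < (‖J (u (e i))‖ ^ 2)⁻¹ := by positivity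
      simp only [mem_ofPred_eq, mem_empty_iff_false, iff_false]
      linarith
    · refine (hfin (Real.sqrt c⁻¹) (by positivity)).subset fun i hi => ?_
      simp only [mem_ofPred_eq] at hi ⊢
      rw [← hi, inv_inv, Real.sqrt_sq (norm_nonneg _)]

theorem exists_isEigensystem_nat [CompleteSpace G] {J : G →L[ℝ] G} (hJ : IsCompactOperator J)
    (hinj : ∀ v, J v = 0 → v = 0) (K : Submodule ℝ G) (hK : IsClosed (K : Set G))
    (hinf : ¬ FiniteDimensional ℝ K) :
    ∃ (P : ℕ → ℝ) (u : ℕ → G), IsEigensystem J K P u := by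
  obtain ⟨u, hu⟩ := exists_greedy_sequence hJ hinj K hK
  have hu' := fun n => hu n (exists_mem_orthIn_ne_zero (fun h => absurd h hinf) u)
  obtain ⟨horth, heig⟩ := greedy_eig (d := fun _ => True) (fun _ _ _ _ => trivial)
    (fun n _ => hu' n)
  have hmem : ∀ n, u n ∈ K := fun n => (mem_orthIn.mp (hu' n).1).1
  have hfin : ∀ δ > 0, {i : ℕ | δ ≤ ‖J (u i)‖}.Finite := by
    intro δ hδ
    by_contra hcon
    have hinfS : {i : ℕ | δ ≤ ‖J (u i)‖}.Infinite := hcon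
    set f := Nat.nth (fun i => δ ≤ ‖J (u i)‖) with hf
    have hfmono : StrictMono f := Nat.nth_strictMono hinfS
    have hfδ : ∀ n, δ ≤ ‖J (u (f n))‖ := fun n => Nat.nth_mem_of_infinite hinfS n
    have hcpt := hJ.isCompact_closure_image_closedBall (f := (J : G →ₗ[ℝ] G)) 1
    obtain ⟨y, -, φ, hφ, hy⟩ := hcpt.tendsto_subseq (x := fun n => J (u (f n)))
      (fun n => subset_closure ⟨u (f n), by simp [(hu' (f n)).2.1], rfl⟩)
    have hc := hy.cauchySeq
    rw [Metric.cauchySeq_iff'] at hc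
    obtain ⟨N, hN⟩ := hc δ hδ
    have h1 := hN (N + 1) (by omega)
    rw [dist_eq_norm] at h1
    simp only [Function.comp] at h1
    -- Orthogonal images of norm at least `δ` are more than `δ` apart, so they have no Cauchy
    -- subsequence.
    have h2 : ⟪J (u (f (φ (N + 1)))), J (u (f (φ N)))⟫_ℝ = 0 := by
      rw [heig _ trivial _ (hmem _), real_inner_comm, horth _ _ trivial
        (hfmono (hφ (Nat.lt_succ_self N))), mul_zero]
    have h3 : ‖J (u (f (φ (N + 1)))) - J (u (f (φ N)))‖ ^ 2 < δ ^ 2 :=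
      pow_lt_pow_left₀ h1 (norm_nonneg _) two_ne_zero
    rw [norm_sub_sq_real, h2] at h3
    nlinarith [hfδ (φ N), hfδ (φ (N + 1))]
  refine ⟨_, _, isEigensystem_of_greedy hinj (K := K) (u := u) (OrderIso.refl ℕ).toOrderEmbedding
    (fun i j _ _ => ⟨i, rfl⟩) (fun n _ => hu' n) ?_ hfin⟩
  -- A vector orthogonal to every `u n` competes in every maximization, so `‖J (u n)‖ ≥ ‖J v‖ / ‖v‖`
  -- for all `n`, against `hfin` unless `J v = 0`.
  intro v hv h
  refine hinj v (norm_eq_zero.mp ?_)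
  by_contra h0
  have hJv : 0 < ‖J v‖ := lt_of_le_of_ne (norm_nonneg _) (Ne.symm h0)
  have hle : ∀ n, ‖J v‖ ≤ ‖J (u n)‖ * ‖v‖ := fun n =>
    (hu' n).2.2 v (mem_orthIn.mpr ⟨hv, by rintro _ ⟨j, -, rfl⟩; exact h j⟩)
  have hv0 : 0 < ‖v‖ := by
    by_contra hneg
    have : ‖v‖ = 0 := le_antisymm (not_lt.mp hneg) (norm_nonneg _)
    have h1 := hle 0
    rw [this, mul_zero] at h1
    linarith
  have := hfin (‖J v‖ / ‖v‖) (by positivity)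
  refine Set.infinite_univ (this.subset fun n _ => ?_)
  simp only [mem_ofPred_eq]
  rw [div_le_iff₀ hv0]
  exact hle n

theorem exists_isEigensystem_fin [CompleteSpace G] {J : G →L[ℝ] G} (hJ : IsCompactOperator J)
    (hinj : ∀ v, J v = 0 → v = 0) (K : Submodule ℝ G) [FiniteDimensional ℝ K]
    {d : ℕ} (hd : Module.finrank ℝ K = d) :
    ∃ (P : Fin d → ℝ) (u : Fin d → G), IsEigensystem J K P u := by
  subst hd
  obtain ⟨u, hu⟩ := exists_greedy_sequence hJ hinj K K.closed_of_finiteDimensional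
  have hr : ∀ n, n ∈ range (Fin.valOrderEmb (Module.finrank ℝ K)) ↔ n < Module.finrank ℝ K := by
    intro n
    constructor
    · rintro ⟨i, rfl⟩; exact i.2
    · intro h; exact ⟨⟨n, h⟩, rfl⟩
  have hu' := fun n (hn : n ∈ range (Fin.valOrderEmb (Module.finrank ℝ K))) =>
    hu n (exists_mem_orthIn_ne_zero (fun _ => (hr n).mp hn) u)
  have he : ∀ i j, i ≤ j → j ∈ range (Fin.valOrderEmb (Module.finrank ℝ K)) →
      i ∈ range (Fin.valOrderEmb (Module.finrank ℝ K)) := by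
    intro i j hij
    rw [hr, hr]
    omega
  obtain ⟨horth, -⟩ := greedy_eig he hu'
  refine ⟨_, _, isEigensystem_of_greedy hinj (K := K) (u := u) (Fin.valOrderEmb _) he hu' ?_
    fun _ _ => Set.toFinite _⟩
  intro v hv h
  have hon : Orthonormal ℝ (fun i : Fin (Module.finrank ℝ K) => u i) := by
    refine ⟨fun i => (hu' _ ⟨i, rfl⟩).2.1, fun i j hij => ?_⟩
    rcases lt_or_gt_of_ne hij with h | h
    · exact horth _ _ ⟨j, rfl⟩ h
    · change ⟪u i, u j⟫_ℝ = 0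
      rw [real_inner_comm]; exact horth _ _ ⟨i, rfl⟩ h
  -- As many orthonormal vectors as the dimension span `K`, so a vector of `K` orthogonal to them is
  -- orthogonal to itself.
  have hspan : Submodule.span ℝ (range fun i : Fin (Module.finrank ℝ K) => u i) = K := by
    refine Submodule.eq_of_le_of_finrank_eq ?_ ?_
    · rw [Submodule.span_le]
      rintro _ ⟨i, rfl⟩
      exact (mem_orthIn.mp (hu' _ ⟨i, rfl⟩).1).1
    · rw [finrank_span_eq_card hon.linearIndependent, Fintype.card_fin]
  have hvspan : v ∈ orthIn K (range fun i : Fin (Module.finrank ℝ K) => u i) := by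
    refine mem_orthIn.mpr ⟨hv, ?_⟩
    rintro _ ⟨i, rfl⟩
    exact h i
  have := hvspan.2 v (by rw [hspan]; exact hv)
  exact inner_self_eq_zero.mp this

end Spectral

/-! ### Multiplicities and the abstract two-sided eigenvalue bound. -/

section Comparison

variable {G : Type} [NormedAddCommGroup G] [InnerProductSpace ℝ G]

/-- The solutions `w ∈ K` of `⟪w, v⟫ = c ⟪J w, J v⟫` for all `v ∈ K`. -/
def eigSpace (J : G →L[ℝ] G) (K : Submodule ℝ G) (c : ℝ) : Submodule ℝ G where
  carrier := {w | w ∈ K ∧ ∀ v ∈ K, ⟪w, v⟫_ℝ = c * ⟪J w, J v⟫_ℝ}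
  zero_mem' := ⟨K.zero_mem, fun v _ => by simp⟩
  add_mem' := by
    rintro a b ⟨ha, ha'⟩ ⟨hb, hb'⟩
    refine ⟨K.add_mem ha hb, fun v hv => ?_⟩
    rw [inner_add_left, ha' v hv, hb' v hv, map_add, inner_add_left, mul_add]
  smul_mem' := by
    rintro t a ⟨ha, ha'⟩
    refine ⟨K.smul_mem t ha, fun v hv => ?_⟩
    rw [inner_smul_left, ha' v hv, map_smul, inner_smul_left]
    ring

namespace IsEigensystem

variable {J : G →L[ℝ] G} {K : Submodule ℝ G} {ι : Type} [LinearOrder ι] {P : ι → ℝ} {u : ι → G}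

lemma mul_norm_sq (h : IsEigensystem J K P u) (i : ι) : P i * ‖J (u i)‖ ^ 2 = 1 := by
  have := h.eig i (u i) (h.mem i)
  rw [real_inner_self_eq_norm_sq, real_inner_self_eq_norm_sq, h.orthonormal.1 i] at this
  linarith

lemma pos (h : IsEigensystem J K P u) (i : ι) : 0 < P i := by
  by_contra hn
  nlinarith [h.mul_norm_sq i, sq_nonneg ‖J (u i)‖]

lemma inner_map (h : IsEigensystem J K P u) {i j : ι} (hij : i ≠ j) :
    ⟪J (u i), J (u j)⟫_ℝ = 0 := by
  have := h.eig i (u j) (h.mem j)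
  rw [h.orthonormal.2 hij] at this
  exact (mul_eq_zero.mp this.symm).resolve_left (h.pos i).ne'

/-- Symmetry of both forms makes a solution orthogonal to every `u i` with `P i ≠ c`. Subtracting
its finite expansion in the remaining `u i` leaves a vector orthogonal to the whole system, which is
zero by completeness. -/
lemma eigSpace_eq_span (h : IsEigensystem J K P u) (c : ℝ) :
    eigSpace J K c = Submodule.span ℝ (u '' {i | P i = c}) := by
  refine le_antisymm ?_ ?_
  · rintro w ⟨hw, hw'⟩
    have hne : ∀ i, P i ≠ c → ⟪u i, w⟫_ℝ = 0 := by
      intro i hi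
      have e1 := hw' (u i) (h.mem i)
      have e2 := h.eig i w hw
      rw [real_inner_comm, real_inner_comm (J (u i)) (J w)] at e1
      rw [e1] at e2
      have : (c - P i) * ⟪J (u i), J w⟫_ℝ = 0 := by linarith
      rcases mul_eq_zero.mp this with h0 | h0
      · exact absurd (by linarith) hi
      · rw [e1, h0, mul_zero]
    set S := (h.finite_fiber c).toFinset with hS
    set p := ∑ i ∈ S, ⟪u i, w⟫_ℝ • u i with hp
    have hwp : w - p = 0 := by
      refine h.complete _ (K.sub_mem hw (K.sum_mem fun i _ => K.smul_mem _ (h.mem i))) fun j => ?_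
      rw [inner_sub_right]
      by_cases hj : P j = c
      · rw [hp, h.orthonormal.inner_right_sum _ (by simpa [hS] using hj), sub_self]
      · rw [hne j hj, hp, inner_sum, Finset.sum_eq_zero, sub_zero]
        intro i hi
        rw [inner_smul_right, h.orthonormal.2, mul_zero]
        rintro rfl
        exact hj (by simpa [hS] using hi)
    rw [sub_eq_zero.mp hwp]
    refine Submodule.sum_mem _ fun i hi => Submodule.smul_mem _ _ (Submodule.subset_span ⟨i, ?_, rfl⟩)
    simpa [hS] using hi
  · rw [Submodule.span_le]
    rintro _ ⟨i, hi, rfl⟩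
    have hi' : P i = c := hi
    exact ⟨h.mem i, fun v hv => by rw [h.eig i v hv, hi']⟩

lemma rank_eigSpace (h : IsEigensystem J K P u) (c : ℝ) :
    Cardinal.mk {i : ι // P i = c} = Module.rank ℝ (eigSpace J K c) := by
  have hli : LinearIndependent ℝ (fun i : {i : ι // P i = c} => u i) :=
    h.orthonormal.linearIndependent.comp _ Subtype.val_injective
  have := rank_span hli
  have hr : range (fun i : {i : ι // P i = c} => u i) = u '' {i | P i = c} := by
    ext x; simp
  rw [h.eigSpace_eq_span, ← hr, this, Cardinal.mk_range_eq _ hli.injective]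

/-- A nontrivial combination of the first eigenvectors satisfying prescribed conditions. -/
lemma exists_combination (h : IsEigensystem J K P u) (i : ι) {n : ℕ} (s : Finset ι)
    (hs : ∀ j ∈ s, j ≤ i) (hcard : n < s.card) (f : G →ₗ[ℝ] (Fin n → ℝ)) :
    ∃ v ∈ K, v ≠ 0 ∧ f v = 0 ∧ ‖v‖ ^ 2 ≤ P i * ‖J v‖ ^ 2 := by
  obtain ⟨a, ha0, ha⟩ := exists_ne_zero_map_eq_zero (E := s → ℝ)
    (f ∘ₗ Fintype.linearCombination ℝ (fun j : s => u j)) (fun _ => by simpa using hcard)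
  have hli : LinearIndependent ℝ (fun j : s => u j) :=
    h.orthonormal.linearIndependent.comp _ Subtype.val_injective
  set v := ∑ j : s, a j • u j with hv
  have hon : Orthonormal ℝ (fun j : s => u j) := h.orthonormal.comp _ Subtype.val_injective
  have hn : ‖v‖ ^ 2 = ∑ j : s, a j ^ 2 := by
    rw [← real_inner_self_eq_norm_sq, hv, hon.inner_sum]
    simp [sq]
  have hJn : ‖J v‖ ^ 2 = ∑ j : s, a j ^ 2 * ‖J (u j)‖ ^ 2 := by
    rw [← real_inner_self_eq_norm_sq, hv, map_sum, sum_inner]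
    refine Finset.sum_congr rfl fun j _ => ?_
    rw [inner_sum, Finset.sum_eq_single j]
    · rw [map_smul, inner_smul_left, inner_smul_right, real_inner_self_eq_norm_sq]
      simp; ring
    · intro k _ hk
      rw [map_smul, map_smul, inner_smul_left, inner_smul_right,
        h.inner_map (fun h => hk (Subtype.ext h.symm)), mul_zero, mul_zero]
    · simp
  refine ⟨v, K.sum_mem fun j _ => K.smul_mem _ (h.mem j), ?_, ?_, ?_⟩
  · intro h0
    exact ha0 (funext fun j => Fintype.linearIndependent_iff.mp hli a h0 j)
  · simpa only [LinearMap.comp_apply, Fintype.linearCombination_apply] using ha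
  · rw [hn, hJn, Finset.mul_sum]
    refine Finset.sum_le_sum fun j _ => ?_
    have h1 := h.mul_norm_sq j
    have h2 := h.mono (hs j j.2)
    nlinarith [mul_nonneg (sq_nonneg (a j)) (mul_nonneg (sub_nonneg.mpr h2)
      (sq_nonneg ‖J (u j)‖))]

end IsEigensystem

/-- Two-sided eigenvalue bounds for the Galerkin approximation on `Kh ≤ K`. -/
theorem eigenvalue_bounds [CompleteSpace G] {J : G →L[ℝ] G} (hinj : ∀ v, J v = 0 → v = 0)
    {K Kh : Submodule ℝ G}
    (hle : Kh ≤ K) [FiniteDimensional ℝ Kh] {d : ℕ} {P : ℕ → ℝ} {u : ℕ → G} {Ph : Fin d → ℝ}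
    {uh : Fin d → G} (h : IsEigensystem J K P u) (hh : IsEigensystem J Kh Ph uh) {C : ℝ}
    (happrox : ∀ w ∈ K, (∀ v ∈ Kh, ⟪v, w⟫_ℝ = 0) → ‖J w‖ ≤ C * ‖w‖) (i : Fin d) :
    Ph i / (1 + Ph i * C ^ 2) ≤ P i ∧ P i ≤ Ph i := by
  have hJpos : ∀ v, v ≠ 0 → 0 < ‖J v‖ ^ 2 := fun v hv => by
    have : 0 < ‖J v‖ := norm_pos_iff.mpr fun h0 => hv (hinj v h0)
    positivity
  constructor
  · have hP := h.pos i
    have hPh := hh.pos i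
    let π := Kh.starProjection
    -- These are `i` linear conditions on a space of dimension `i + 1`; they are imposed on the
    -- projection `π v`, not on `v`.
    let f : G →ₗ[ℝ] (Fin (i : ℕ) → ℝ) := LinearMap.pi fun j : Fin (i : ℕ) =>
      (innerSL ℝ (uh ⟨j, j.2.trans i.2⟩) : G →ₗ[ℝ] ℝ) ∘ₗ (π : G →ₗ[ℝ] G)
    obtain ⟨v, hvK, hv0, hfv, hv⟩ := h.exists_combination (i : ℕ) (Finset.range (i + 1))
      (fun j hj => by simpa [Nat.lt_succ_iff] using hj) (by simp) f
    have hπv : π v ∈ Kh := Submodule.starProjection_apply_mem Kh v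
    have h1 : Ph i * ‖J (π v)‖ ^ 2 ≤ ‖π v‖ ^ 2 := by
      refine hh.minimal i _ hπv fun j hj => ?_
      exact congr_fun hfv ⟨j, hj⟩
    have h2 : ‖J (v - π v)‖ ≤ C * ‖v - π v‖ := by
      refine happrox _ (K.sub_mem hvK (hle hπv)) fun z hz => ?_
      exact Submodule.sub_starProjection_mem_orthogonal (K := Kh) v z hz
    have h3 : ‖v‖ ^ 2 = ‖π v‖ ^ 2 + ‖v - π v‖ ^ 2 := by
      have : ⟪π v, v - π v⟫_ℝ = 0 :=
        Submodule.sub_starProjection_mem_orthogonal (K := Kh) v _ hπv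
      have e := norm_add_sq_real (π v) (v - π v)
      rw [this, add_sub_cancel] at e
      linarith
    have h4 : ‖J v‖ ≤ ‖J (π v)‖ + ‖J (v - π v)‖ := by
      have := norm_add_le (J (π v)) (J (v - π v))
      rwa [← map_add, add_sub_cancel] at this
    have h5 : ‖J v‖ ^ 2 ≤ (1 / Ph i + C ^ 2) * ‖v‖ ^ 2 := by
      set x := ‖J (π v)‖
      set y := ‖v - π v‖
      have hx : 0 ≤ x := norm_nonneg _
      have hy : 0 ≤ y := norm_nonneg _
      have h6 : ‖J v‖ ^ 2 ≤ (x + C * y) ^ 2 :=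
        pow_le_pow_left₀ (norm_nonneg _) (by linarith) 2
      -- Cauchy-Schwarz for the vectors `(1/√Ph, C)` and `(√Ph · x, y)`, with the defect written as
      -- an explicit square.
      have h7 : (x + C * y) ^ 2 ≤ (1 / Ph i + C ^ 2) * (Ph i * x ^ 2 + y ^ 2) := by
        have e : (1 / Ph i + C ^ 2) * (Ph i * x ^ 2 + y ^ 2) - (x + C * y) ^ 2 =
            (1 / Ph i) * (y - C * Ph i * x) ^ 2 := by
          field_simp; ring
        have : 0 ≤ (1 / Ph i) * (y - C * Ph i * x) ^ 2 := by positivity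
        linarith
      have h8 : (1 / Ph i + C ^ 2) * (Ph i * x ^ 2 + y ^ 2) ≤ (1 / Ph i + C ^ 2) * ‖v‖ ^ 2 := by
        have : 0 ≤ 1 / Ph i + C ^ 2 := by positivity
        rw [h3]
        exact mul_le_mul_of_nonneg_left (by linarith) this
      linarith
    have hvn : 0 < ‖v‖ ^ 2 := by have := norm_pos_iff.mpr hv0; positivity
    have h9 : 1 ≤ P i * (1 / Ph i + C ^ 2) := by
      have : ‖v‖ ^ 2 ≤ (P i * (1 / Ph i + C ^ 2)) * ‖v‖ ^ 2 := by nlinarith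
      by_contra hlt
      push Not at hlt
      nlinarith
    rw [div_le_iff₀ (by positivity)]
    have : P i * (1 + Ph i * C ^ 2) = Ph i * (P i * (1 / Ph i + C ^ 2)) := by field_simp
    rw [this]
    nlinarith
  -- Min-max with the roles exchanged: a combination of discrete eigenvectors orthogonal to the
  -- first exact ones is a trial vector for `P i`.
  · let f : G →ₗ[ℝ] (Fin (i : ℕ) → ℝ) := LinearMap.pi fun j : Fin (i : ℕ) =>
      (innerSL ℝ (u j) : G →ₗ[ℝ] ℝ)
    obtain ⟨v, hvK, hv0, hfv, hv⟩ := hh.exists_combination i (Finset.Iic i)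
      (fun j hj => by simpa using hj) (by simp) f
    have h1 : P i * ‖J v‖ ^ 2 ≤ ‖v‖ ^ 2 :=
      h.minimal i v (hle hvK) fun j hj => congr_fun hfv ⟨j, hj⟩
    exact le_of_mul_le_mul_right (h1.trans hv) (hJpos v hv0)

end Comparison

/-- Nondecreasing lists are determined by how often each value occurs. -/
lemma eq_of_monotone_of_card_fiber_eq {ι : Type} [LinearOrder ι] [LocallyFiniteOrderBot ι]
    {P Q : ι → ℝ} (hP : Monotone P) (hQ : Monotone Q)
    (h : ∀ c, Cardinal.mk {i // P i = c} = Cardinal.mk {i // Q i = c}) : P = Q := by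
  -- If `P i < Q i`, monotonicity forces the value-preserving bijection `σ` to map `Iic i` into the
  -- strictly smaller set `Iio i`.
  have key : ∀ {P Q : ι → ℝ}, Monotone P → Monotone Q → ∀ σ : ι ≃ ι, (∀ i, Q (σ i) = P i) →
      ∀ i, Q i ≤ P i := by
    intro P Q hP hQ σ hσ i
    by_contra! hlt
    have hmaps : ∀ j ∈ Finset.Iic i, σ j ∈ Finset.Iio i := by
      intro j hj
      rw [Finset.mem_Iio]
      by_contra! hle
      have h1 := hQ hle
      rw [hσ] at h1
      linarith [hP (Finset.mem_Iic.mp hj)]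
    have hcard := Finset.card_le_card_of_injOn σ hmaps σ.injective.injOn
    have : (Finset.Iio i).card < (Finset.Iic i).card := by
      refine Finset.card_lt_card (Finset.ssubset_iff_of_subset ?_ |>.mpr ⟨i, by simp, by simp⟩)
      intro j hj
      exact Finset.mem_Iic.mpr (Finset.mem_Iio.mp hj).le
    omega
  have e : ∀ c, Nonempty ({i // P i = c} ≃ {i // Q i = c}) := fun c => Cardinal.eq.mp (h c)
  -- The fiberwise bijections are glued to a permutation that carries `P` to `Q`.
  let σ : ι ≃ ι := (Equiv.sigmaFiberEquiv P).symm.trans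
    ((Equiv.sigmaCongrRight fun c => (e c).some).trans (Equiv.sigmaFiberEquiv Q))
  have hσ : ∀ i, Q (σ i) = P i := fun i => ((e (P i)).some ⟨i, rfl⟩).2
  funext i
  refine le_antisymm ?_ (key hP hQ σ hσ i)
  refine key hQ hP σ.symm (fun j => ?_) i
  rw [← hσ, Equiv.apply_symm_apply]

/-! ### Integration by parts for primitives and Wirtinger's inequality. -/

section Primitives

/-- Integration by parts for a primitive `F` of an integrable function `f`. -/
lemma integral_primitive_mul_deriv {a b C : ℝ} (hab : a ≤ b) {f F φ : ℝ → ℝ}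
    (hf : IntervalIntegrable f volume a b) (hF : ∀ x ∈ Icc a b, F x = C + ∫ t in a..x, f t)
    (hφ : ContDiff ℝ 1 φ) :
    ∫ x in a..b, F x * deriv φ x = F b * φ b - F a * φ a - ∫ x in a..b, f x * φ x := by
  set F₀ : ℝ → ℝ := fun x => ∫ t in a..x, f t with hF₀
  have hac : AbsolutelyContinuousOnInterval F₀ a b :=
    hf.absolutelyContinuousOnInterval_intervalIntegral (c := a) (by simp)
  have hφac : AbsolutelyContinuousOnInterval φ a b :=
    hφ.contDiffOn.absolutelyContinuousOnInterval
  have key := hac.integral_mul_deriv_eq_deriv_mul hφac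
  have hder : ∫ x in a..b, deriv F₀ x * φ x = ∫ x in a..b, f x * φ x := by
    refine intervalIntegral.integral_congr_ae ?_
    filter_upwards [hf.ae_hasDerivAt_integral] with x hx hxab
    rw [(hx (uIoc_subset_uIcc hxab) a (by simp)).deriv]
  have hφ' : ∫ x in a..b, deriv φ x = φ b - φ a :=
    intervalIntegral.integral_deriv_eq_sub (fun x _ => hφ.differentiable (by simp) x)
      ((hφ.continuous_deriv (by simp)).intervalIntegrable _ _)
  have hsplit : ∫ x in a..b, F x * deriv φ x =
      C * (∫ x in a..b, deriv φ x) + ∫ x in a..b, F₀ x * deriv φ x := by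
    rw [← intervalIntegral.integral_const_mul, ← intervalIntegral.integral_add]
    · refine intervalIntegral.integral_congr fun x hx => ?_
      rw [uIcc_of_le hab] at hx
      simp only [hF x hx, hF₀]
      ring
    · exact (continuous_const.mul (hφ.continuous_deriv (by simp))).intervalIntegrable _ _
    · refine ContinuousOn.intervalIntegrable ?_
      exact hac.continuousOn.mul (hφ.continuous_deriv (by simp)).continuousOn
  have ha : F a = C := by rw [hF a ⟨le_rfl, hab⟩]; simp
  have hb : F b = C + F₀ b := hF b ⟨hab, le_rfl⟩
  have h0 : F₀ a = 0 := by simp [hF₀]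
  rw [hsplit, key, hder, hφ', ha, hb, h0]
  ring

/-- The real formula applied to the real and imaginary parts of `φ`. It is needed for Fourier
coefficients, where `φ'` is an exponential and `φ` its antiderivative. -/
lemma integral_primitive_mul_deriv_complex {a b C : ℝ} (hab : a ≤ b) {f F : ℝ → ℝ} {φ φ' : ℝ → ℂ}
    (hf : IntervalIntegrable f volume a b) (hF : ∀ x ∈ Icc a b, F x = C + ∫ t in a..x, f t)
    (hφ : ∀ x, HasDerivAt φ (φ' x) x) (hφ' : Continuous φ') (ha : F a = 0) (hb : F b = 0) :
    ∫ x in a..b, φ' x * (F x : ℂ) = - ∫ x in a..b, φ x * (f x : ℂ) := by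
  have hφc : Continuous φ := continuous_iff_continuousAt.mpr fun x => (hφ x).continuousAt
  have hFc : ContinuousOn F (uIcc a b) := by
    rw [uIcc_of_le hab]
    refine ContinuousOn.congr ?_ hF
    have := intervalIntegral.continuousOn_primitive_interval' hf left_mem_uIcc
    rw [uIcc_of_le hab] at this
    exact continuousOn_const.add this
  have i1 : IntervalIntegrable (fun x => φ' x * (F x : ℂ)) volume a b :=
    (hφ'.continuousOn.mul (Complex.continuous_ofReal.comp_continuousOn hFc)).intervalIntegrable
  have i2 : IntervalIntegrable (fun x => φ x * (f x : ℂ)) volume a b :=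
    IntervalIntegrable.continuousOn_mul ⟨hf.1.ofReal, hf.2.ofReal⟩ hφc.continuousOn
  have part : ∀ (ℓ : ℂ →L[ℝ] ℝ), (∀ (z : ℂ) (r : ℝ), ℓ (z * r) = ℓ z * r) →
      ℓ (∫ x in a..b, φ' x * (F x : ℂ)) = - ℓ (∫ x in a..b, φ x * (f x : ℂ)) := by
    intro ℓ hℓ
    rw [← ℓ.intervalIntegral_comp_comm i1, ← ℓ.intervalIntegral_comp_comm i2]
    have hd : ∀ x, HasDerivAt (fun x => ℓ (φ x)) (ℓ (φ' x)) x := fun x =>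
      ℓ.hasFDerivAt.comp_hasDerivAt x (hφ x)
    have hde : deriv (fun x => ℓ (φ x)) = fun x => ℓ (φ' x) := funext fun x => (hd x).deriv
    have hcd : ContDiff ℝ 1 (fun x => ℓ (φ x)) := by
      rw [contDiff_one_iff_deriv, hde]
      exact ⟨fun x => (hd x).differentiableAt, ℓ.continuous.comp hφ'⟩
    have := integral_primitive_mul_deriv hab hf hF hcd
    rw [ha, hb, hde] at this
    simp only [hℓ]
    simp only [mul_comm (F _), mul_comm (f _), zero_mul, sub_zero, zero_sub] at this
    exact this
  refine Complex.ext ?_ ?_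
  · simpa using part Complex.reCLM (by simp)
  · simpa using part Complex.imCLM (by simp)

/-- Wirtinger's inequality for periodic functions with mean value zero. -/
theorem wirtinger {a b : ℝ} (hab : a < b) {f F : ℝ → ℝ}
    (hf : MemLp f 2 (volume.restrict (Ioc a b))) (hF : ∀ x ∈ Icc a b, F x = ∫ t in a..x, f t)
    (hb : F b = 0) (hmean : ∫ x in a..b, F x = 0) :
    ∫ x in a..b, F x ^ 2 ≤ ((b - a) / (2 * Real.pi)) ^ 2 * ∫ x in a..b, f x ^ 2 := by
  have hfi : IntervalIntegrable f volume a b := by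
    rw [intervalIntegrable_iff_integrableOn_Ioc_of_le hab.le]
    exact hf.integrable (by norm_num)
  have ha : F a = 0 := by rw [hF a ⟨le_rfl, hab.le⟩]; simp
  have hF' : ∀ x ∈ Icc a b, F x = 0 + ∫ t in a..x, f t := by simpa using hF
  have hFc : ContinuousOn F (Icc a b) := by
    refine ContinuousOn.congr ?_ hF
    have := intervalIntegral.continuousOn_primitive_interval' hfi left_mem_uIcc
    rwa [uIcc_of_le hab.le] at this
  have hFL : MemLp F 2 (volume.restrict (Ioc a b)) := by
    have h1 : MemLp F 2 (volume.restrict (Icc a b)) := by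
      obtain ⟨B, hB⟩ := isCompact_Icc.exists_bound_of_continuousOn hFc
      exact MemLp.of_bound (hFc.aestronglyMeasurable measurableSet_Icc) B
        ((ae_restrict_iff' measurableSet_Icc).mpr (Eventually.of_forall hB))
    exact h1.mono_measure (Measure.restrict_mono Ioc_subset_Icc_self le_rfl)
  have s1 := hasSum_sq_fourierCoeffOn hab (f := fun x => (F x : ℂ)) hFL.ofReal
  have s2 := hasSum_sq_fourierCoeffOn hab (f := fun x => (f x : ℂ)) hf.ofReal
  have hpos : 0 < b - a := sub_pos.mpr hab
  -- By Parseval it suffices to compare coefficients. The one with `n = 0` vanishes by the mean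
  -- value condition; for the others integration by parts, without boundary terms, gives the factor
  -- `(b - a) / (2π|n|)`, and `|n| ≥ 1`.
  have hcoef : ∀ n : ℤ, ‖fourierCoeffOn hab (fun x => (F x : ℂ)) n‖ ^ 2 ≤
      ((b - a) / (2 * Real.pi)) ^ 2 * ‖fourierCoeffOn hab (fun x => (f x : ℂ)) n‖ ^ 2 := by
    intro n
    rcases eq_or_ne n 0 with rfl | hn
    · have : fourierCoeffOn hab (fun x => (F x : ℂ)) 0 = 0 := by
        rw [fourierCoeffOn_eq_integral]
        simp [intervalIntegral.integral_ofReal, hmean]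
      rw [this]
      rw [norm_zero, zero_pow two_ne_zero]
      positivity
    · have hT : Fact (0 < b - a) := ⟨hpos⟩
      have hib := integral_primitive_mul_deriv_complex hab.le hfi hF'
        (φ := fun y : ℝ => ((b - a : ℝ) : ℂ) / (-2 * Real.pi * Complex.I * n) *
          fourier (-n) (y : AddCircle (b - a)))
        (φ' := fun y : ℝ => fourier (-n) (y : AddCircle (b - a)))
        (fun x => has_antideriv_at_fourier_neg hT hn x)
        ((map_continuous _).comp (AddCircle.continuous_mk' _)) ha hb
      have e : fourierCoeffOn hab (fun x => (F x : ℂ)) n =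
          (((b - a : ℝ) : ℂ) / (2 * Real.pi * Complex.I * n)) *
            fourierCoeffOn hab (fun x => (f x : ℂ)) n := by
        rw [fourierCoeffOn_eq_integral, fourierCoeffOn_eq_integral]
        simp only [smul_eq_mul]
        rw [hib]
        simp only [mul_assoc, intervalIntegral.integral_const_mul]
        rw [mul_smul_comm, ← neg_mul]
        congr 2
        rw [neg_mul, div_neg, neg_neg]
      rw [e, norm_mul, mul_pow]
      refine mul_le_mul_of_nonneg_right ?_ (sq_nonneg _)
      refine pow_le_pow_left₀ (norm_nonneg _) ?_ 2
      rw [norm_div]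
      have h1 : ‖((b - a : ℝ) : ℂ)‖ = b - a := by
        rw [Complex.norm_real, Real.norm_of_nonneg hpos.le]
      have h2 : ‖(2 * Real.pi * Complex.I * n : ℂ)‖ = 2 * Real.pi * |(n : ℝ)| := by
        simp [abs_of_pos Real.pi_pos]
      rw [h1, h2]
      have h3 : (1 : ℝ) ≤ |(n : ℝ)| := by exact_mod_cast Int.one_le_abs hn
      have hpi := Real.pi_pos
      exact div_le_div_of_nonneg_left hpos.le (by positivity) (by nlinarith)
  have := hasSum_le hcoef s1 (s2.mul_left _)
  simp only [Complex.norm_real, Real.norm_eq_abs, sq_abs, smul_eq_mul] at this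
  have h4 : (b - a)⁻¹ * (∫ x in a..b, F x ^ 2) ≤
      (b - a)⁻¹ * (((b - a) / (2 * Real.pi)) ^ 2 * ∫ x in a..b, f x ^ 2) := by
    linarith [this]
  exact le_of_mul_le_mul_left h4 (inv_pos.mpr hpos)

end Primitives

/-! ### Weak derivatives: uniqueness and representation by primitives. -/

section WeakDerivatives

variable {L : ℝ}

lemma MemL2.integrableOn {f : ℝ → ℝ} (hf : MemL2 L f) : IntegrableOn f (Ioo 0 L) :=
  MemLp.integrable (by norm_num) hf

lemma MemL2.intervalIntegrable {f : ℝ → ℝ} (hf : MemL2 L f) (hL : 0 < L) :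
    IntervalIntegrable f volume 0 L := by
  rw [intervalIntegrable_iff_integrableOn_Ioo_of_le hL.le]
  exact hf.integrableOn

lemma HasWeakDeriv.congr {f g f' g' : ℝ → ℝ} (h : HasWeakDeriv L f g)
    (hf : f =ᵐ[volume.restrict (Ioo 0 L)] f') (hg : g =ᵐ[volume.restrict (Ioo 0 L)] g') :
    HasWeakDeriv L f' g' := by
  intro φ hφ
  have h1 := h φ hφ
  have e1 : ∫ x in Ioo 0 L, f x * deriv φ x = ∫ x in Ioo 0 L, f' x * deriv φ x :=
    integral_congr_ae (hf.mono fun x hx => by simp only [hx])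
  have e2 : ∫ x in Ioo 0 L, g x * φ x = ∫ x in Ioo 0 L, g' x * φ x :=
    integral_congr_ae (hg.mono fun x hx => by simp only [hx])
  rw [← e1, ← e2, h1]

lemma ae_eq_zero_of_integral_test {f : ℝ → ℝ} (hf : IntegrableOn f (Ioo 0 L))
    (h : ∀ φ, IsTestFunction L φ → ∫ x in Ioo 0 L, f x * φ x = 0) :
    f =ᵐ[volume.restrict (Ioo 0 L)] 0 := by
  have := isOpen_Ioo.ae_eq_zero_of_integral_contDiff_smul_eq_zero (μ := volume)
    (U := Ioo 0 L) hf.locallyIntegrableOn fun g h1 h2 h3 => by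
      have e := h g ⟨h1, h2, h3⟩
      rw [← e, ← integral_indicator measurableSet_Ioo]
      refine integral_congr_ae (Eventually.of_forall fun x => ?_)
      by_cases hx : x ∈ Ioo 0 L
      · simp [hx, mul_comm]
      · have : g x = 0 := by
          by_contra h0
          exact hx (h3 (subset_tsupport _ h0))
        simp [hx, this]
  exact (ae_restrict_iff' measurableSet_Ioo).mpr this

lemma HasWeakDeriv.ae_eq {f g g' : ℝ → ℝ} (hg : MemL2 L g) (hg' : MemL2 L g')
    (h : HasWeakDeriv L f g) (h' : HasWeakDeriv L f g') :
    g =ᵐ[volume.restrict (Ioo 0 L)] g' := by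
  have : (g - g') =ᵐ[volume.restrict (Ioo 0 L)] 0 := by
    refine ae_eq_zero_of_integral_test (hg.integrableOn.sub hg'.integrableOn) fun φ hφ => ?_
    have e1 := h φ hφ
    have e2 := h' φ hφ
    simp only [Pi.sub_apply, sub_mul]
    rw [integral_sub (hg.integrable_mul_test hφ.1.continuous hφ.2.1)
      (hg'.integrable_mul_test hφ.1.continuous hφ.2.1)]
    linarith
  filter_upwards [this] with x hx
  simpa [sub_eq_zero] using hx

/-- Uniqueness makes the arbitrarily chosen representative harmless: the forms can be evaluated with
any weak derivative known explicitly. -/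
lemma weakDeriv_ae_eq {f g : ℝ → ℝ} (hg : MemL2 L g) (h : HasWeakDeriv L f g) :
    weakDeriv L f =ᵐ[volume.restrict (Ioo 0 L)] g := by
  have hex : ∃ g : ℝ → ℝ, MemL2 L g ∧ HasWeakDeriv L f g := ⟨g, hg, h⟩
  unfold weakDeriv
  rw [dif_pos hex]
  exact HasWeakDeriv.ae_eq hex.choose_spec.1 hg hex.choose_spec.2 h

lemma weakDeriv_weakDeriv_ae_eq {f g k : ℝ → ℝ} (hg : MemL2 L g) (hk : MemL2 L k)
    (h : HasWeakDeriv L f g) (h' : HasWeakDeriv L g k) :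
    weakDeriv L (weakDeriv L f) =ᵐ[volume.restrict (Ioo 0 L)] k :=
  weakDeriv_ae_eq hk (h'.congr (weakDeriv_ae_eq hg h).symm EventuallyEq.rfl)

lemma IsTestFunction.eq_zero {φ : ℝ → ℝ} (hφ : IsTestFunction L φ) {x : ℝ} (hx : x ∉ Ioo 0 L) :
    φ x = 0 := by
  by_contra h0
  exact hx (hφ.2.2 (subset_tsupport _ h0))

lemma hasWeakDeriv_of_primitive {C : ℝ} (hL : 0 < L) {f F : ℝ → ℝ}
    (hf : IntervalIntegrable f volume 0 L) (hF : ∀ x ∈ Icc 0 L, F x = C + ∫ t in (0)..x, f t) :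
    HasWeakDeriv L F f := by
  intro φ hφ
  have := integral_primitive_mul_deriv hL.le hf hF (hφ.1.of_le (by exact_mod_cast le_top))
  rw [hφ.eq_zero (x := 0) (by simp), hφ.eq_zero (x := L) (by simp),
    intervalIntegral.integral_of_le hL.le, intervalIntegral.integral_of_le hL.le,
    integral_Ioc_eq_integral_Ioo, integral_Ioc_eq_integral_Ioo] at this
  simpa using this

lemma exists_test_integral_eq_one (hL : 0 < L) :
    ∃ ψ, IsTestFunction L ψ ∧ ∫ x in Ioo 0 L, ψ x = 1 := by
  let b : ContDiffBump (L / 2) := ⟨L / 8, L / 4, by positivity, by linarith⟩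
  have hsub : tsupport (b.normed volume) ⊆ Ioo 0 L := by
    rw [b.tsupport_normed_eq, Real.closedBall_eq_Icc]
    intro x hx
    have h1 : L / 2 - L / 4 ≤ x := hx.1
    have h2 : x ≤ L / 2 + L / 4 := hx.2
    exact ⟨by linarith, by linarith⟩
  refine ⟨b.normed volume, ⟨b.contDiff_normed, b.hasCompactSupport_normed, hsub⟩, ?_⟩
  rw [← b.integral_normed (μ := volume)]
  refine setIntegral_eq_integral_of_forall_compl_eq_zero fun x hx => ?_
  by_contra h0
  exact hx (hsub (subset_tsupport _ h0))

/-- A primitive that vanishes to the left of the support is constant to its right, and that constant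
is the integral, hence zero. -/
lemma IsTestFunction.exists_primitive (hL : 0 < L) {φ : ℝ → ℝ} (hφ : IsTestFunction L φ)
    (h0 : ∫ x in Ioo 0 L, φ x = 0) : ∃ Φ, IsTestFunction L Φ ∧ deriv Φ = φ := by
  obtain ⟨a, b, ha, hb, hab⟩ : ∃ a b, 0 < a ∧ b < L ∧ tsupport φ ⊆ Icc a b := by
    rcases (tsupport φ).eq_empty_or_nonempty with he | hne
    · exact ⟨L / 2, L / 2, by linarith, by linarith, by simp [he]⟩
    · obtain ⟨a, ha⟩ := hφ.2.1.isCompact.exists_isLeast hne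
      obtain ⟨b, hb⟩ := hφ.2.1.isCompact.exists_isGreatest hne
      exact ⟨a, b, (hφ.2.2 ha.1).1, (hφ.2.2 hb.1).2, fun x hx => ⟨ha.2 hx, hb.2 hx⟩⟩
  have hz : ∀ x, x ∉ Icc a b → φ x = 0 := fun x hx => by
    by_contra h1
    exact hx (hab (subset_tsupport _ h1))
  have hc := hφ.1.continuous
  set Φ : ℝ → ℝ := fun x => ∫ t in (0)..x, φ t with hΦ
  have hd : deriv Φ = φ := funext fun x => hc.deriv_integral _ _ _
  have hdiff : Differentiable ℝ Φ := fun x =>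
    (intervalIntegral.integral_hasDerivAt_right (hc.intervalIntegrable _ _)
      (hc.stronglyMeasurableAtFilter _ _) hc.continuousAt).differentiableAt
  have hΦz : ∀ x, x ∉ Icc a b → Φ x = 0 := by
    intro x hx
    rcases lt_or_ge x a with h | h
    · refine intervalIntegral.integral_zero_ae (Eventually.of_forall fun t ht => hz t fun h' => ?_)
      rcases le_total 0 x with h2 | h2
      · rw [uIoc_of_le h2] at ht; linarith [ht.2, h'.1]
      · rw [uIoc_of_ge h2] at ht; linarith [ht.2, h'.1]
    · have hbx : b < x := by
        by_contra h1
        exact hx ⟨h, not_lt.mp h1⟩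
      have e : Φ x = Φ L + ∫ t in L..x, φ t :=
        (intervalIntegral.integral_add_adjacent_intervals (hc.intervalIntegrable _ _)
          (hc.intervalIntegrable _ _)).symm
      have e1 : Φ L = 0 := by
        rw [hΦ]
        simp only
        rw [intervalIntegral.integral_of_le hL.le, integral_Ioc_eq_integral_Ioo, h0]
      rw [e, e1, zero_add]
      refine intervalIntegral.integral_zero_ae (Eventually.of_forall fun t ht => hz t fun h' => ?_)
      rcases le_total L x with h2 | h2
      · rw [uIoc_of_le h2] at ht; linarith [ht.1, h'.2]
      · rw [uIoc_of_ge h2] at ht; linarith [ht.1, h'.2]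
  have hsupp : tsupport Φ ⊆ Icc a b := by
    refine closure_minimal (fun x hx => ?_) isClosed_Icc
    by_contra h1
    exact hx (hΦz x h1)
  refine ⟨Φ, ⟨?_, ?_, hsupp.trans fun x hx => ⟨ha.trans_le hx.1, hx.2.trans_lt hb⟩⟩, hd⟩
  · rw [contDiff_infty_iff_deriv, hd]
    exact ⟨hdiff, hφ.1⟩
  · exact isCompact_Icc.of_isClosed_subset (isClosed_tsupport _) hsupp

/-- A function with weak derivative zero is constant. -/
lemma exists_ae_eq_const_of_hasWeakDeriv_zero (hL : 0 < L) {f : ℝ → ℝ} (hf : MemL2 L f)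
    (h : HasWeakDeriv L f 0) : ∃ c, f =ᵐ[volume.restrict (Ioo 0 L)] fun _ => c := by
  obtain ⟨ψ, hψ, hψ1⟩ := exists_test_integral_eq_one hL
  have hone : MemL2 L (fun _ => (1 : ℝ)) := memLp_const 1
  have hti : ∀ {φ}, IsTestFunction L φ → Integrable φ (volume.restrict (Ioo 0 L)) := fun hφ => by
    simpa using hone.integrable_mul_test hφ.1.continuous hφ.2.1
  set c := ∫ x in Ioo 0 L, f x * ψ x with hc
  refine ⟨c, ?_⟩
  have hconst : MemL2 L (fun _ => c) := memLp_const c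
  have : (f - fun _ => c) =ᵐ[volume.restrict (Ioo 0 L)] 0 := by
    refine ae_eq_zero_of_integral_test (hf.integrableOn.sub hconst.integrableOn) fun φ hφ => ?_
    set m := ∫ x in Ioo 0 L, φ x with hm
    -- The argument of du Bois-Reymond: subtracting the right multiple of the fixed bump `ψ` makes
    -- the mean zero, so the difference is the derivative of a test function.
    have hχ : IsTestFunction L (φ - m • ψ) := by
      refine ⟨hφ.1.sub (hψ.1.const_smul m), hφ.2.1.sub (hψ.2.1.smul_left (f := fun _ => m)), ?_⟩
      refine (tsupport_sub _ _).trans (union_subset hφ.2.2 ?_)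
      exact (tsupport_smul_subset_right (fun _ => m) ψ).trans hψ.2.2
    have hχ0 : ∫ x in Ioo 0 L, (φ - m • ψ) x = 0 := by
      simp only [Pi.sub_apply, Pi.smul_apply, smul_eq_mul]
      rw [integral_sub (hti hφ) ((hti hψ).const_mul m), integral_const_mul, hψ1, ← hm]
      ring
    obtain ⟨Φ, hΦ, hΦd⟩ := hχ.exists_primitive hL hχ0
    have e := h Φ hΦ
    rw [hΦd] at e
    simp only [Pi.sub_apply, Pi.smul_apply, smul_eq_mul, Pi.zero_apply, zero_mul, integral_zero,
      neg_zero, mul_sub, mul_left_comm (f _) m] at e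
    rw [integral_sub (hf.integrable_mul_test hφ.1.continuous hφ.2.1)
      ((hf.integrable_mul_test hψ.1.continuous hψ.2.1).const_mul m), integral_const_mul, ← hc] at e
    simp only [Pi.sub_apply, sub_mul]
    rw [integral_sub (hf.integrable_mul_test hφ.1.continuous hφ.2.1) ((hti hφ).const_mul c),
      integral_const_mul, ← hm]
    linarith
  filter_upwards [this] with x hx
  simpa [sub_eq_zero] using hx

lemma continuousOn_primitive {f : ℝ → ℝ} (hL : 0 < L) (hf : IntervalIntegrable f volume 0 L) :
    ContinuousOn (fun x => ∫ t in (0)..x, f t) (Icc 0 L) := by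
  have := intervalIntegral.continuousOn_primitive_interval' hf left_mem_uIcc
  rwa [uIcc_of_le hL.le] at this

lemma memL2_of_continuousOn {f : ℝ → ℝ} (hf : ContinuousOn f (Icc 0 L)) : MemL2 L f := by
  obtain ⟨B, hB⟩ := isCompact_Icc.exists_bound_of_continuousOn hf
  have h1 : MemLp f 2 (volume.restrict (Icc 0 L)) :=
    MemLp.of_bound (hf.aestronglyMeasurable measurableSet_Icc) B
      ((ae_restrict_iff' measurableSet_Icc).mpr (Eventually.of_forall hB))
  exact h1.mono_measure (Measure.restrict_mono Ioo_subset_Icc_self le_rfl)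

/-- The difference of `f` and the primitive of `g` has weak derivative zero and is therefore
constant. -/
lemma HasWeakDeriv.exists_ae_eq_primitive (hL : 0 < L) {f g : ℝ → ℝ} (hf : MemL2 L f)
    (hg : MemL2 L g) (h : HasWeakDeriv L f g) :
    ∃ c, f =ᵐ[volume.restrict (Ioo 0 L)] fun x => c + ∫ t in (0)..x, g t := by
  set F : ℝ → ℝ := fun x => ∫ t in (0)..x, g t with hF
  have hgi := hg.intervalIntegrable hL
  have hFL : MemL2 L F := memL2_of_continuousOn (continuousOn_primitive hL hgi)
  have hFw : HasWeakDeriv L F g := hasWeakDeriv_of_primitive (C := 0) hL hgi (by simp [hF])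
  obtain ⟨c, hc⟩ := exists_ae_eq_const_of_hasWeakDeriv_zero hL (f := f + (-1 : ℝ) • F)
    (hf.add (hFL.const_smul _)) (by
      have := h.add hf (hFL.const_smul _) hg (hg.const_smul (-1 : ℝ)) (hFw.smul (-1))
      convert this using 1
      ext x; simp)
  refine ⟨c, ?_⟩
  filter_upwards [hc] with x hx
  simp only [Pi.add_apply, Pi.smul_apply, smul_eq_mul] at hx
  linarith

lemma eqOn_of_ae_eq_of_continuousOn (hL : 0 < L) {f g : ℝ → ℝ} (hf : ContinuousOn f (Icc 0 L))
    (hg : ContinuousOn g (Icc 0 L)) (h : f =ᵐ[volume.restrict (Ioo 0 L)] g) :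
    EqOn f g (Icc 0 L) := by
  have h1 : EqOn f g (Ioo 0 L) :=
    Measure.eqOn_open_of_ae_eq h isOpen_Ioo (hf.mono Ioo_subset_Icc_self)
      (hg.mono Ioo_subset_Icc_self)
  exact h1.of_subset_closure hf hg Ioo_subset_Icc_self (by rw [closure_Ioo hL.ne])

end WeakDerivatives

/-! ### Weighted primitives as operators on `L²(0,L)`, and compactness. -/

/-- The Hilbert space `L²(0,L)`. -/
abbrev L2 (L : ℝ) : Type := Lp ℝ 2 (volume.restrict (Ioo 0 L))

/-- A bounded measurable function. -/
structure IsBoundedWeight (s : ℝ → ℝ) : Prop where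
  measurable : Measurable s
  bounded : ∃ B, 0 ≤ B ∧ ∀ x, |s x| ≤ B

/-- The function `g s`, extended by zero outside `(0,L)`. -/
def weighted {L : ℝ} (s : ℝ → ℝ) (g : L2 L) : ℝ → ℝ := (Ioo 0 L).indicator fun x => g x * s x

section Operators

variable {L : ℝ} {s : ℝ → ℝ}

lemma ae_volume_of_ae_restrict {p : ℝ → Prop} (h : ∀ᵐ x ∂(volume.restrict (Ioo 0 L)), p x) :
    ∀ᵐ x, x ∈ Ioo 0 L → p x := (ae_restrict_iff' measurableSet_Ioo).mp h

lemma weighted_ae_eq (s : ℝ → ℝ) (g : L2 L) :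
    weighted s g =ᵐ[volume.restrict (Ioo 0 L)] fun x => g x * s x :=
  (ae_restrict_iff' measurableSet_Ioo).mpr (Eventually.of_forall fun x hx => by
    simp only [weighted, indicator_of_mem hx])

lemma IsBoundedWeight.memL2_mul (hs : IsBoundedWeight s) {g : ℝ → ℝ} (hg : MemL2 L g) :
    MemL2 L fun x => g x * s x := by
  obtain ⟨B, -, hB⟩ := hs.bounded
  refine MemLp.of_le_mul (c := B) hg
    (hg.aestronglyMeasurable.mul hs.measurable.aestronglyMeasurable)
    (Eventually.of_forall fun x => ?_)
  rw [norm_mul, mul_comm]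
  exact mul_le_mul_of_nonneg_right (hB x) (norm_nonneg _)

lemma memL2_coeFn (g : L2 L) : MemL2 L g := Lp.memLp g

lemma memL2_weighted (hs : IsBoundedWeight s) (g : L2 L) : MemL2 L (weighted s g) :=
  (memLp_congr_ae (weighted_ae_eq s g)).mpr (hs.memL2_mul (memL2_coeFn g))

lemma integrable_weighted (hs : IsBoundedWeight s) (g : L2 L) : Integrable (weighted s g) := by
  rw [weighted, integrable_indicator_iff measurableSet_Ioo]
  exact (hs.memL2_mul (memL2_coeFn g)).integrableOn

/-- The primitive of `g s` vanishing at `0`. -/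
def primitive (hs : IsBoundedWeight s) : L2 L →ₗ[ℝ] (ℝ → ℝ) where
  toFun g x := ∫ t in (0)..x, weighted s g t
  map_add' g k := by
    funext x
    simp only [Pi.add_apply]
    rw [← intervalIntegral.integral_add (integrable_weighted hs g).intervalIntegrable
      (integrable_weighted hs k).intervalIntegrable]
    refine intervalIntegral.integral_congr_ae ?_
    filter_upwards [ae_volume_of_ae_restrict (Lp.coeFn_add g k)] with t ht _
    by_cases h : t ∈ Ioo 0 L
    · simp only [weighted, indicator_of_mem h, ht h, Pi.add_apply]; ring
    · simp only [weighted, indicator_of_notMem h, add_zero]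
  map_smul' c g := by
    funext x
    simp only [Pi.smul_apply, RingHom.id_apply, smul_eq_mul]
    rw [← intervalIntegral.integral_const_mul]
    refine intervalIntegral.integral_congr_ae ?_
    filter_upwards [ae_volume_of_ae_restrict (Lp.coeFn_smul c g)] with t ht _
    by_cases h : t ∈ Ioo 0 L
    · simp only [weighted, indicator_of_mem h, ht h, Pi.smul_apply, smul_eq_mul]; ring
    · simp only [weighted, indicator_of_notMem h, mul_zero]

lemma primitive_apply (hs : IsBoundedWeight s) (g : L2 L) (x : ℝ) :
    primitive hs g x = ∫ t in (0)..x, weighted s g t := rfl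

lemma continuous_primitive (hs : IsBoundedWeight s) (g : L2 L) : Continuous (primitive hs g) :=
  intervalIntegral.continuous_primitive
    (fun _ _ => (integrable_weighted hs g).intervalIntegrable) 0

/-- The second primitive of `g s`. -/
def secondPrimitive (hs : IsBoundedWeight s) : L2 L →ₗ[ℝ] (ℝ → ℝ) where
  toFun g x := ∫ t in (0)..x, primitive hs g t
  map_add' g k := by
    funext x
    simp only [map_add, Pi.add_apply]
    exact intervalIntegral.integral_add ((continuous_primitive hs g).intervalIntegrable _ _)
      ((continuous_primitive hs k).intervalIntegrable _ _)
  map_smul' c g := by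
    funext x
    simp only [map_smul, Pi.smul_apply, RingHom.id_apply, smul_eq_mul]
    exact intervalIntegral.integral_const_mul _ _

lemma secondPrimitive_apply (hs : IsBoundedWeight s) (g : L2 L) (x : ℝ) :
    secondPrimitive hs g x = ∫ t in (0)..x, primitive hs g t := rfl

lemma hasDerivAt_secondPrimitive (hs : IsBoundedWeight s) (g : L2 L) (x : ℝ) :
    HasDerivAt (secondPrimitive hs g) (primitive hs g x) x :=
  intervalIntegral.integral_hasDerivAt_right ((continuous_primitive hs g).intervalIntegrable _ _)
    ((continuous_primitive hs g).stronglyMeasurableAtFilter _ _)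
    (continuous_primitive hs g).continuousAt

/-- The second primitive of `g s` on `[0,L]`, extended by zero. -/
def deflection (hs : IsBoundedWeight s) : L2 L →ₗ[ℝ] (ℝ → ℝ) where
  toFun g := (Icc 0 L).indicator (secondPrimitive hs g)
  map_add' g k := by rw [map_add, indicator_add']
  map_smul' c g := by
    rw [map_smul]
    exact indicator_const_smul (Icc 0 L) c (secondPrimitive hs g)

lemma deflection_of_mem (hs : IsBoundedWeight s) (g : L2 L) {x : ℝ} (hx : x ∈ Icc 0 L) :
    deflection hs g x = secondPrimitive hs g x := indicator_of_mem hx _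

/-- The element of `L²(0,L)` given by a square integrable function. -/
def toL2 {f : ℝ → ℝ} (hf : MemL2 L f) : L2 L := MemLp.toLp f hf

lemma toL2_ae_eq {f : ℝ → ℝ} (hf : MemL2 L f) :
    toL2 hf =ᵐ[volume.restrict (Ioo 0 L)] f := MemLp.coeFn_toLp hf

lemma IsBoundedWeight.memL2_indicator (hs : IsBoundedWeight s) {A : Set ℝ}
    (hA : MeasurableSet A) : MemL2 L (A.indicator s) := by
  obtain ⟨B, hB0, hB⟩ := hs.bounded
  refine MemLp.of_bound (hs.measurable.indicator hA).aestronglyMeasurable B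
    (Eventually.of_forall fun x => ?_)
  exact (norm_indicator_le_norm_self _ _).trans (hB x)

/-- The scalar products with `kernel A` are the integrals of `g s` over `A ∩ (0,L)`. -/
def kernel (hs : IsBoundedWeight s) {A : Set ℝ} (hA : MeasurableSet A) : L2 L :=
  toL2 (hs.memL2_indicator hA)

lemma inner_kernel (hs : IsBoundedWeight s) {A : Set ℝ} (hA : MeasurableSet A) (g : L2 L) :
    ⟪kernel hs hA, g⟫_ℝ = ∫ x in A, weighted s g x := by
  rw [L2.inner_def, weighted, setIntegral_indicator measurableSet_Ioo, inter_comm,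
    ← setIntegral_indicator hA]
  refine integral_congr_ae ?_
  filter_upwards [toL2_ae_eq (L := L) (hs.memL2_indicator hA)] with x hx
  have : (kernel hs hA : L2 L) x = A.indicator s x := hx
  simp only [this]
  by_cases h : x ∈ A <;> simp [h]

lemma inner_kernel_Ioc (hs : IsBoundedWeight s) {x y : ℝ} (hxy : x ≤ y) (g : L2 L) :
    ⟪kernel hs (measurableSet_Ioc (a := x) (b := y)), g⟫_ℝ =
      primitive hs g y - primitive hs g x := by
  rw [inner_kernel, ← intervalIntegral.integral_of_le hxy, primitive_apply, primitive_apply,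
    intervalIntegral.integral_interval_sub_left
      (integrable_weighted hs g).intervalIntegrable (integrable_weighted hs g).intervalIntegrable]

lemma norm_kernel_Ioc_sq_le (hs : IsBoundedWeight s) {B : ℝ} (hB0 : 0 ≤ B)
    (hB : ∀ x, |s x| ≤ B) {x y : ℝ} (hxy : x ≤ y) :
    ‖(kernel hs (measurableSet_Ioc (a := x) (b := y)) : L2 L)‖ ^ 2 ≤ B ^ 2 * (y - x) := by
  rw [← real_inner_self_eq_norm_sq, inner_kernel]
  refine (le_abs_self _).trans ?_
  have := norm_setIntegral_le_of_norm_le_const_ae' (μ := volume) (s := Ioc x y) (C := B ^ 2)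
    (f := weighted s (kernel hs (measurableSet_Ioc (a := x) (b := y)) : L2 L)) (by simp) ?_
  · simpa [Measure.real, hxy] using this
  · filter_upwards [ae_volume_of_ae_restrict (toL2_ae_eq (L := L)
      (hs.memL2_indicator (measurableSet_Ioc (a := x) (b := y))))] with t ht htm
    by_cases h : t ∈ Ioo 0 L
    · have e : (kernel hs (measurableSet_Ioc (a := x) (b := y)) : L2 L) t = s t := by
        rw [← indicator_of_mem htm s]; exact ht h
      rw [weighted, indicator_of_mem h, e, norm_mul, sq]
      exact mul_le_mul (hB t) (hB t) (norm_nonneg _) hB0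
    · rw [weighted, indicator_of_notMem h, norm_zero]; positivity

/-- Hölder continuity with exponent 1/2: the increment is an inner product with a kernel whose norm
is at most `B √(y - x)`. Boundedness and compactness of `slope` both rest on this. -/
lemma abs_primitive_sub_le (hs : IsBoundedWeight s) {B : ℝ} (hB0 : 0 ≤ B)
    (hB : ∀ x, |s x| ≤ B) {x y : ℝ} (hxy : x ≤ y) (g : L2 L) :
    |primitive hs g y - primitive hs g x| ≤ B * √(y - x) * ‖g‖ := by
  rw [← inner_kernel_Ioc hs hxy]
  refine (abs_real_inner_le_norm _ _).trans (mul_le_mul_of_nonneg_right ?_ (norm_nonneg _))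
  have h := norm_kernel_Ioc_sq_le (L := L) hs hB0 hB hxy
  rw [← Real.sqrt_sq hB0, ← Real.sqrt_mul (sq_nonneg B)]
  exact Real.le_sqrt_of_sq_le h

lemma primitive_zero (hs : IsBoundedWeight s) (g : L2 L) : primitive hs g 0 = 0 := by
  simp [primitive_apply]

lemma memL2_primitive (hs : IsBoundedWeight s) (g : L2 L) : MemL2 L (primitive hs g) :=
  memL2_of_continuousOn (continuous_primitive hs g).continuousOn

/-- The linear map underlying `slope`. -/
def slopeLinear (hs : IsBoundedWeight s) : L2 L →ₗ[ℝ] L2 L where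
  toFun g := toL2 (memL2_primitive hs g)
  map_add' g k := by
    refine Lp.ext ?_
    filter_upwards [toL2_ae_eq (memL2_primitive hs (g + k)), toL2_ae_eq (memL2_primitive hs g),
      toL2_ae_eq (memL2_primitive hs k),
      Lp.coeFn_add (toL2 (memL2_primitive hs g)) (toL2 (memL2_primitive hs k))] with x h1 h2 h3 h4
    rw [h1, h4, Pi.add_apply, h2, h3, map_add, Pi.add_apply]
  map_smul' c g := by
    refine Lp.ext ?_
    filter_upwards [toL2_ae_eq (memL2_primitive hs (c • g)), toL2_ae_eq (memL2_primitive hs g),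
      Lp.coeFn_smul c (toL2 (memL2_primitive hs g))] with x h1 h2 h3
    rw [RingHom.id_apply, h1, h3, Pi.smul_apply, h2, map_smul, Pi.smul_apply]

lemma slopeLinear_ae_eq (hs : IsBoundedWeight s) (g : L2 L) :
    slopeLinear hs g =ᵐ[volume.restrict (Ioo 0 L)] primitive hs g :=
  toL2_ae_eq (memL2_primitive hs g)

lemma norm_slopeLinear_le (hL : 0 < L) (hs : IsBoundedWeight s) (g : L2 L) {C : ℝ} (hC : 0 ≤ C)
    (h : ∀ x ∈ Ioo 0 L, |primitive hs g x| ≤ C) : ‖slopeLinear hs g‖ ≤ √L * C := by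
  have := Lp.norm_le_of_ae_bound (f := slopeLinear hs g) hC (by
    filter_upwards [slopeLinear_ae_eq hs g, ae_restrict_mem measurableSet_Ioo] with x hx hx'
    rw [hx]
    exact h x hx')
  refine this.trans_eq ?_
  congr 1
  simp [measureUnivNNReal, Real.sqrt_eq_rpow, ENNReal.coe_toNNReal_eq_toReal]
  rw [ENNReal.toReal_ofReal hL.le]

/-- The operator `g ↦ ∫₀ˣ g s` on `L²(0,L)`. -/
def slope (hL : 0 < L) (hs : IsBoundedWeight s) : L2 L →L[ℝ] L2 L :=
  (slopeLinear hs).mkContinuousOfExistsBound (by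
    obtain ⟨B, hB0, hB⟩ := hs.bounded
    refine ⟨√L * (B * √L), fun g => ?_⟩
    rw [mul_assoc]
    refine norm_slopeLinear_le hL hs g (by positivity) fun x hx => ?_
    have := abs_primitive_sub_le hs hB0 hB hx.1.le g
    rw [primitive_zero, sub_zero, sub_zero] at this
    refine this.trans ?_
    have := Real.sqrt_le_sqrt hx.2.le
    gcongr)

lemma slope_ae_eq (hL : 0 < L) (hs : IsBoundedWeight s) (g : L2 L) :
    slope hL hs g =ᵐ[volume.restrict (Ioo 0 L)] primitive hs g := slopeLinear_ae_eq hs g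

lemma exists_finiteDimensional_norm_slope_le (hL : 0 < L) (hs : IsBoundedWeight s) {B : ℝ}
    (hB0 : 0 ≤ B) (hB : ∀ x, |s x| ≤ B) (n : ℕ) :
    ∃ F : Submodule ℝ (L2 L), FiniteDimensional ℝ F ∧
      ∀ g ∈ Fᗮ, ‖slope hL hs g‖ ≤ √L * (B * √(L / (n + 1))) * ‖g‖ := by
  -- Orthogonality to these kernels makes the primitive vanish at every grid point `j L / (n + 1)`.
  -- Between grid points the Hölder estimate keeps it small.
  set κ : ℕ → L2 L := fun j => kernel hs (measurableSet_Ioc (a := 0) (b := j * (L / (n + 1))))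
  refine ⟨Submodule.span ℝ (κ '' Iic (n + 1)),
    FiniteDimensional.span_of_finite ℝ ((finite_Iic _).image κ), fun g hg => ?_⟩
  have hδ : 0 < L / (n + 1) := by positivity
  rw [mul_assoc]
  refine norm_slopeLinear_le hL hs g (by positivity) fun x hx => ?_
  set j := ⌊x / (L / (n + 1))⌋₊
  have h1 : (j : ℝ) * (L / (n + 1)) ≤ x := by
    rw [← le_div_iff₀ hδ]; exact Nat.floor_le (div_nonneg hx.1.le hδ.le)
  have h2 : x ≤ (j + 1) * (L / (n + 1)) := by
    rw [← div_le_iff₀ hδ]; exact (Nat.lt_floor_add_one _).le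
  have hj : j ≤ n + 1 := by
    have : (j : ℝ) * (L / (n + 1)) ≤ (n + 1 : ℝ) * (L / (n + 1)) := by
      have : (n + 1 : ℝ) * (L / (n + 1)) = L := by field_simp
      linarith [hx.2]
    exact_mod_cast le_of_mul_le_mul_right this hδ
  have h3 : primitive hs g (j * (L / (n + 1))) = 0 := by
    have := inner_kernel_Ioc hs (x := 0) (y := j * (L / (n + 1))) (by positivity) g
    rw [primitive_zero, sub_zero] at this
    rw [← this]
    exact hg _ (Submodule.subset_span ⟨j, hj, rfl⟩)
  have h4 := abs_primitive_sub_le hs hB0 hB h1 g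
  rw [h3, sub_zero] at h4
  refine h4.trans ?_
  have : √(x - j * (L / (n + 1))) ≤ √(L / (n + 1)) := Real.sqrt_le_sqrt (by linarith)
  gcongr

/-- The operator is the norm limit of its compositions with orthogonal projections onto the
finite-dimensional spaces of kernels. -/
theorem isCompactOperator_slope (hL : 0 < L) (hs : IsBoundedWeight s) :
    IsCompactOperator (slope hL hs) := by
  obtain ⟨B, hB0, hB⟩ := hs.bounded
  choose F hF hFle using exists_finiteDimensional_norm_slope_le hL hs hB0 hB
  have hcpt : ∀ n, IsCompactOperator (slope hL hs ∘L (F n).starProjection) := by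
    intro n
    have : ProperSpace (F n) := FiniteDimensional.proper ℝ _
    have h1 : IsCompactOperator (slope hL hs ∘L (F n).subtypeL) :=
      isCompactOperator_of_locallyCompactSpace_rng _
    exact h1.comp_clm (F n).orthogonalProjectionOnto
  refine isCompactOperator_of_tendsto (F := fun n => slope hL hs ∘L (F n).starProjection)
    (l := atTop) ?_ (Eventually.of_forall hcpt)
  rw [tendsto_iff_norm_sub_tendsto_zero]
  have hlim : Tendsto (fun n : ℕ => √L * (B * √(L / (n + 1)))) atTop (𝓝 0) := by
    have h0 : Tendsto (fun n : ℕ => L / ((n : ℝ) + 1)) atTop (𝓝 0) := by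
      have := (tendsto_one_div_add_atTop_nhds_zero_nat (𝕜 := ℝ)).const_mul L
      simpa [mul_one_div, div_eq_mul_inv] using this
    have h1 := ((Real.continuous_sqrt.tendsto 0).comp h0).const_mul B |>.const_mul √L
    simpa using h1
  refine squeeze_zero (fun _ => norm_nonneg _) (fun n => ?_) hlim
  refine ContinuousLinearMap.opNorm_le_bound _ (by positivity) fun g => ?_
  have e : (slope hL hs ∘L (F n).starProjection - slope hL hs) g =
      - slope hL hs (g - (F n).starProjection g) := by
    simp [map_sub]
  rw [e, norm_neg]
  refine (hFle n _ (Submodule.sub_starProjection_mem_orthogonal g)).trans ?_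
  have : ‖g - (F n).starProjection g‖ ≤ ‖g‖ := by
    have := (F n).norm_sq_eq_add_norm_sq_starProjection g
    rw [Submodule.starProjection_orthogonal_val] at this
    nlinarith [norm_nonneg g, norm_nonneg (g - (F n).starProjection g),
      sq_nonneg ‖(F n).starProjection g‖]
  gcongr

end Operators

/-! ### The dictionary between `V` with its forms and subspaces of `L²(0,L)`. -/

section Representation

variable {L : ℝ} {s : ℝ → ℝ}

lemma hasWeakDeriv_primitive (hL : 0 < L) (hs : IsBoundedWeight s) (g : L2 L) :
    HasWeakDeriv L (primitive hs g) (weighted s g) :=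
  hasWeakDeriv_of_primitive (C := 0) hL (integrable_weighted hs g).intervalIntegrable
    fun x _ => by rw [zero_add, primitive_apply]

lemma hasWeakDeriv_deflection (hL : 0 < L) (hs : IsBoundedWeight s) (g : L2 L) :
    HasWeakDeriv L (deflection hs g) (primitive hs g) :=
  hasWeakDeriv_of_primitive (C := 0) hL ((continuous_primitive hs g).intervalIntegrable _ _)
    fun x hx => by rw [zero_add, deflection_of_mem hs g hx, secondPrimitive_apply]

lemma weakDeriv_deflection (hL : 0 < L) (hs : IsBoundedWeight s) (g : L2 L) :
    weakDeriv L (deflection hs g) =ᵐ[volume.restrict (Ioo 0 L)] primitive hs g :=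
  weakDeriv_ae_eq (memL2_primitive hs g) (hasWeakDeriv_deflection hL hs g)

lemma weakDeriv_weakDeriv_deflection (hL : 0 < L) (hs : IsBoundedWeight s) (g : L2 L) :
    weakDeriv L (weakDeriv L (deflection hs g)) =ᵐ[volume.restrict (Ioo 0 L)]
      fun x => g x * s x :=
  (weakDeriv_weakDeriv_ae_eq (memL2_primitive hs g) (memL2_weighted hs g)
    (hasWeakDeriv_deflection hL hs g) (hasWeakDeriv_primitive hL hs g)).trans (weighted_ae_eq s g)

lemma continuous_secondPrimitive (hs : IsBoundedWeight s) (g : L2 L) :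
    Continuous (secondPrimitive hs g) :=
  continuous_iff_continuousAt.mpr fun x => (hasDerivAt_secondPrimitive hs g x).continuousAt

lemma memH2_deflection (hL : 0 < L) (hs : IsBoundedWeight s) (g : L2 L) :
    MemH2 L (deflection hs g) :=
  ⟨memL2_of_continuousOn ((continuous_secondPrimitive hs g).continuousOn.congr
      fun _ hx => deflection_of_mem hs g hx),
    _, _, memL2_primitive hs g, memL2_weighted hs g, hasWeakDeriv_deflection hL hs g,
    hasWeakDeriv_primitive hL hs g⟩

/-- The `g` for which both primitives of `g s` vanish at `L`. -/
def clamped (L : ℝ) {s : ℝ → ℝ} (hs : IsBoundedWeight s) : Submodule ℝ (L2 L) :=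
  LinearMap.ker (LinearMap.proj L ∘ₗ primitive hs) ⊓
    LinearMap.ker (LinearMap.proj L ∘ₗ secondPrimitive hs)

lemma mem_clamped {hs : IsBoundedWeight s} {g : L2 L} :
    g ∈ clamped L hs ↔ primitive hs g L = 0 ∧ secondPrimitive hs g L = 0 := Iff.rfl

/-- Both end conditions are zeros of continuous functionals: the inner product of `g` with a kernel,
and that of `slope hL hs g` with the constant `1`. -/
lemma isClosed_clamped (hL : 0 < L) (hs : IsBoundedWeight s) :
    IsClosed (clamped L hs : Set (L2 L)) := by
  have h1 : MemL2 L (fun _ => (1 : ℝ)) := memLp_const 1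
  have e : (clamped L hs : Set (L2 L)) =
      {g | ⟪kernel hs (measurableSet_Ioc (a := 0) (b := L)), g⟫_ℝ = 0} ∩
      {g | ⟪toL2 h1, slope hL hs g⟫_ℝ = 0} := by
    ext g
    refine and_congr ?_ ?_
    · change primitive hs g L = 0 ↔ ⟪kernel hs (measurableSet_Ioc (a := 0) (b := L)), g⟫_ℝ = 0
      rw [inner_kernel_Ioc hs hL.le, primitive_zero, sub_zero]
    · change secondPrimitive hs g L = 0 ↔ ⟪toL2 h1, slope hL hs g⟫_ℝ = 0
      rw [L2.inner_def, secondPrimitive_apply, intervalIntegral.integral_of_le hL.le,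
        integral_Ioc_eq_integral_Ioo]
      have : ∫ x in Ioo 0 L, primitive hs g x =
          ∫ x in Ioo 0 L, ⟪toL2 h1 x, slope hL hs g x⟫_ℝ := by
        refine integral_congr_ae ?_
        filter_upwards [toL2_ae_eq h1, slope_ae_eq hL hs g] with x hx hx'
        simp [hx, hx']
      rw [this]
  rw [e]
  exact (isClosed_eq (continuous_const.inner continuous_id) continuous_const).inter
    (isClosed_eq (continuous_const.inner (slope hL hs).continuous) continuous_const)

lemma hasDerivWithinAt_deflection (hs : IsBoundedWeight s) (g : L2 L) {x : ℝ} (hx : x ∈ Icc 0 L) :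
    HasDerivWithinAt (deflection hs g) (primitive hs g x) (Icc 0 L) x :=
  (hasDerivAt_secondPrimitive hs g x).hasDerivWithinAt.congr
    (fun _ hy => deflection_of_mem hs g hy) (deflection_of_mem hs g hx)

lemma contDiff_secondPrimitive (hs : IsBoundedWeight s) (g : L2 L) :
    ContDiff ℝ 1 (secondPrimitive hs g) := by
  have hd : deriv (secondPrimitive hs g) = primitive hs g :=
    funext fun x => (hasDerivAt_secondPrimitive hs g x).deriv
  rw [contDiff_one_iff_deriv, hd]
  exact ⟨fun x => (hasDerivAt_secondPrimitive hs g x).differentiableAt, continuous_primitive hs g⟩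

lemma deflection_mem_V (hL : 0 < L) (hs : IsBoundedWeight s) {g : L2 L} (hg : g ∈ clamped L hs) :
    deflection hs g ∈ V L := by
  obtain ⟨h1, h2⟩ := mem_clamped.mp hg
  have m0 : (0 : ℝ) ∈ Icc 0 L := ⟨le_rfl, hL.le⟩
  have mL : L ∈ Icc 0 L := ⟨hL.le, le_rfl⟩
  refine ⟨memH2_deflection hL hs g, ?_, fun x hx => indicator_of_notMem hx _, ?_, ?_, ?_, ?_⟩
  · exact (contDiff_secondPrimitive hs g).contDiffOn.congr fun _ hx => deflection_of_mem hs g hx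
  · rw [deflection_of_mem hs g m0]; simp [secondPrimitive_apply]
  · have := hasDerivWithinAt_deflection hs g m0
    rwa [primitive_zero] at this
  · rw [deflection_of_mem hs g mL, h2]
  · have := hasDerivWithinAt_deflection hs g mL
    rwa [h1] at this

/-- Take `g = u'' / s`. Then `u` is the second primitive of `g s` up to an affine function; the
conditions at `0` remove that function and those at `L` say that `g` is clamped. -/
lemma exists_deflection_eq (hL : 0 < L) (hs : IsBoundedWeight s)
    (hinv : ∃ B, ∀ᵐ x ∂(volume.restrict (Ioo 0 L)), s x ≠ 0 ∧ |(s x)⁻¹| ≤ B)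
    {u : ℝ → ℝ} (hu : u ∈ V L) : ∃ g ∈ clamped L hs, deflection hs g = u := by
  obtain ⟨⟨huL, u₁, u₂, h1, h2, d1, d2⟩, hC1, hout, hu0, hd0, huL0, hdL⟩ := hu
  obtain ⟨B, hB⟩ := hinv
  have hg : MemL2 L fun x => u₂ x * (s x)⁻¹ := by
    refine MemLp.of_le_mul (c := B) h2
      (h2.aestronglyMeasurable.mul hs.measurable.inv.aestronglyMeasurable) ?_
    filter_upwards [hB] with x hx
    rw [norm_mul, mul_comm]
    exact mul_le_mul_of_nonneg_right hx.2 (norm_nonneg _)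
  set g := toL2 hg with hgdef
  have hw : weighted s g =ᵐ[volume.restrict (Ioo 0 L)] u₂ := by
    filter_upwards [weighted_ae_eq s g, toL2_ae_eq hg, hB] with x e1 e2 e3
    rw [e1, hgdef, e2, mul_assoc, inv_mul_cancel₀ e3.1, mul_one]
  have hp : ∀ x ∈ Icc 0 L, ∫ t in (0)..x, u₂ t = primitive hs g x := by
    intro x hx
    rw [primitive_apply]
    refine intervalIntegral.integral_congr_ae_restrict ?_
    rw [uIoc_of_le hx.1, ← restrict_Ioo_eq_restrict_Ioc]
    exact EventuallyEq.symm (ae_restrict_of_ae_restrict_of_subset (Ioo_subset_Ioo_right hx.2) hw)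
  obtain ⟨c₁, hc₁⟩ := d2.exists_ae_eq_primitive hL h1 h2
  obtain ⟨c₀, hc₀⟩ := d1.exists_ae_eq_primitive hL huL h1
  have hc₁' : u₁ =ᵐ[volume.restrict (Ioo 0 L)] fun x => c₁ + primitive hs g x := by
    filter_upwards [hc₁, ae_restrict_mem measurableSet_Ioo] with x hx hx'
    rw [hx, hp x (Ioo_subset_Icc_self hx')]
  have hcont : Continuous fun x => c₁ + primitive hs g x :=
    continuous_const.add (continuous_primitive hs g)
  have hu₁ : ∀ x ∈ Icc 0 L, ∫ t in (0)..x, u₁ t = c₁ * x + secondPrimitive hs g x := by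
    intro x hx
    have e : ∫ t in (0)..x, u₁ t = ∫ t in (0)..x, (c₁ + primitive hs g t) := by
      refine intervalIntegral.integral_congr_ae_restrict ?_
      rw [uIoc_of_le hx.1, ← restrict_Ioo_eq_restrict_Ioc]
      exact ae_restrict_of_ae_restrict_of_subset (Ioo_subset_Ioo_right hx.2) hc₁'
    rw [e, intervalIntegral.integral_add (continuous_const.intervalIntegrable _ _)
      ((continuous_primitive hs g).intervalIntegrable _ _), secondPrimitive_apply]
    simp [mul_comm]
  have hEq : EqOn u (fun x => c₀ + (c₁ * x + secondPrimitive hs g x)) (Icc 0 L) := by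
    refine eqOn_of_ae_eq_of_continuousOn hL hC1.continuousOn
      (continuous_const.add ((continuous_const.mul continuous_id).add
        (continuous_secondPrimitive hs g))).continuousOn ?_
    filter_upwards [hc₀, ae_restrict_mem measurableSet_Ioo] with x hx hx'
    rw [hx, hu₁ x (Ioo_subset_Icc_self hx')]
  have m0 : (0 : ℝ) ∈ Icc 0 L := ⟨le_rfl, hL.le⟩
  have mL : L ∈ Icc 0 L := ⟨hL.le, le_rfl⟩
  have hder : ∀ x ∈ Icc 0 L, HasDerivWithinAt u (c₁ + primitive hs g x) (Icc 0 L) x := by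
    intro x hx
    have := (((hasDerivAt_id x).const_mul c₁).add (hasDerivAt_secondPrimitive hs g x)).const_add c₀
    rw [mul_one] at this
    exact this.hasDerivWithinAt.congr hEq (hEq hx)
  have hud := uniqueDiffOn_Icc hL
  have c1z : c₁ = 0 := by
    have := (hud 0 m0).eq_deriv _ (hder 0 m0) hd0
    rwa [primitive_zero, add_zero] at this
  have c0z : c₀ = 0 := by
    have := hEq m0
    simp only [hu0, mul_zero, secondPrimitive_apply, intervalIntegral.integral_same] at this
    linarith
  subst c1z c0z
  refine ⟨g, mem_clamped.mpr ⟨?_, ?_⟩, ?_⟩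
  · have := (hud L mL).eq_deriv _ (hder L mL) hdL
    rwa [zero_add] at this
  · have := hEq mL
    simp only [huL0] at this
    linarith
  · funext x
    by_cases hx : x ∈ Icc 0 L
    · rw [deflection_of_mem hs g hx, hEq hx]; ring
    · rw [hout x hx]; exact indicator_of_notMem hx _

lemma map_clamped (hL : 0 < L) (hs : IsBoundedWeight s)
    (hinv : ∃ B, ∀ᵐ x ∂(volume.restrict (Ioo 0 L)), s x ≠ 0 ∧ |(s x)⁻¹| ≤ B) :
    (clamped L hs).map (deflection hs) = V L := by
  ext u
  constructor
  · rintro ⟨g, hg, rfl⟩; exact deflection_mem_V hL hs hg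
  · intro hu
    obtain ⟨g, hg, rfl⟩ := exists_deflection_eq hL hs hinv hu
    exact ⟨g, hg, rfl⟩

lemma eq_zero_of_primitive_ae_eq_zero (hL : 0 < L) (hs : IsBoundedWeight s)
    (h0 : ∀ᵐ x ∂(volume.restrict (Ioo 0 L)), s x ≠ 0) {g : L2 L}
    (hg : primitive hs g =ᵐ[volume.restrict (Ioo 0 L)] 0) : g = 0 := by
  have hz : MemL2 L 0 := MemLp.zero
  have h1 : HasWeakDeriv L (primitive hs g) 0 :=
    HasWeakDeriv.congr (f := 0) (fun φ _ => by simp) hg.symm EventuallyEq.rfl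
  have h2 := (hasWeakDeriv_primitive hL hs g).ae_eq (memL2_weighted hs g) hz h1
  refine Lp.ext ?_
  filter_upwards [h2, weighted_ae_eq s g, h0, Lp.coeFn_zero ℝ 2 (volume.restrict (Ioo 0 L))]
    with x e1 e2 e3 e4
  rw [e4]
  rw [e2] at e1
  exact (mul_eq_zero.mp e1).resolve_right e3

lemma slope_injective (hL : 0 < L) (hs : IsBoundedWeight s)
    (h0 : ∀ᵐ x ∂(volume.restrict (Ioo 0 L)), s x ≠ 0) (g : L2 L) (hg : slope hL hs g = 0) :
    g = 0 := by
  refine eq_zero_of_primitive_ae_eq_zero hL hs h0 ?_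
  refine (slope_ae_eq hL hs g).symm.trans ?_
  rw [hg]
  exact Lp.coeFn_zero _ _ _

lemma deflection_injective (hL : 0 < L) (hs : IsBoundedWeight s)
    (h0 : ∀ᵐ x ∂(volume.restrict (Ioo 0 L)), s x ≠ 0) :
    Function.Injective (deflection (L := L) hs) := by
  rw [← LinearMap.ker_eq_bot, LinearMap.ker_eq_bot']
  intro g hg
  refine eq_zero_of_primitive_ae_eq_zero hL hs h0 ?_
  have h := hasWeakDeriv_deflection hL hs g
  rw [hg] at h
  exact h.ae_eq (memL2_primitive hs g) (g' := 0) MemLp.zero (fun φ _ => by simp)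

/-- This is the reason for the weight: `s²` cancels `EI`, and the energy becomes the standard inner
product. -/
lemma formA_deflection (hL : 0 < L) (hs : IsBoundedWeight s) {EI : ℝ → ℝ}
    (hEI : ∀ᵐ x ∂(volume.restrict (Ioo 0 L)), EI x * s x ^ 2 = 1) (g k : L2 L) :
    formA L EI (deflection hs g) (deflection hs k) = ⟪g, k⟫_ℝ := by
  rw [formA, L2.inner_def]
  refine integral_congr_ae ?_
  filter_upwards [hEI, weakDeriv_weakDeriv_deflection hL hs g,
    weakDeriv_weakDeriv_deflection hL hs k] with x h1 h2 h3
  rw [h2, h3]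
  simp only [RCLike.inner_apply, conj_trivial]
  linear_combination (g x * k x) * h1

lemma formB_deflection (hL : 0 < L) (hs : IsBoundedWeight s) (g k : L2 L) :
    formB L (deflection hs g) (deflection hs k) = ⟪slope hL hs g, slope hL hs k⟫_ℝ := by
  rw [formB, L2.inner_def]
  refine integral_congr_ae ?_
  filter_upwards [weakDeriv_deflection hL hs g, weakDeriv_deflection hL hs k,
    slope_ae_eq hL hs g, slope_ae_eq hL hs k] with x h1 h2 h3 h4
  rw [h1, h2, h3, h4]
  simp [mul_comm]

lemma eigenspace_map_deflection (hL : 0 < L) (hs : IsBoundedWeight s) {EI : ℝ → ℝ}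
    (hEI : ∀ᵐ x ∂(volume.restrict (Ioo 0 L)), EI x * s x ^ 2 = 1)
    (K : Submodule ℝ (L2 L)) (c : ℝ) :
    eigenspace L EI (K.map (deflection hs)) c =
      (eigSpace (slope hL hs) K c).map (deflection hs) := by
  have h0 : ∀ᵐ x ∂(volume.restrict (Ioo 0 L)), s x ≠ 0 := by
    filter_upwards [hEI] with x hx h
    rw [h] at hx
    simp at hx
  have hinj := deflection_injective hL hs h0
  refine le_antisymm (Submodule.span_le.mpr ?_) ?_
  · rintro _ ⟨⟨g, hg, rfl⟩, -, h⟩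
    refine ⟨g, ⟨hg, fun k hk => ?_⟩, rfl⟩
    rw [← formA_deflection hL hs hEI, ← formB_deflection]
    exact h _ ⟨k, hk, rfl⟩
  · rintro _ ⟨g, ⟨hg, hg'⟩, rfl⟩
    rcases eq_or_ne g 0 with rfl | hne
    · rw [map_zero]; exact Submodule.zero_mem _
    · refine Submodule.subset_span ⟨⟨g, hg, rfl⟩, fun h => hne (hinj (by rw [h, map_zero])), ?_⟩
      rintro _ ⟨k, hk, rfl⟩
      rw [formA_deflection hL hs hEI, formB_deflection hL]
      exact hg' k hk

lemma isEigenvalueEnumeration_map_iff (hL : 0 < L) (hs : IsBoundedWeight s) {EI : ℝ → ℝ}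
    (hEI : ∀ᵐ x ∂(volume.restrict (Ioo 0 L)), EI x * s x ^ 2 = 1)
    (K : Submodule ℝ (L2 L)) {ι : Type} [LinearOrder ι] (P : ι → ℝ) :
    IsEigenvalueEnumeration L EI (K.map (deflection hs)) P ↔
      Monotone P ∧ ∀ c, Cardinal.mk {i // P i = c} =
        Module.rank ℝ (eigSpace (slope hL hs) K c) := by
  have h0 : ∀ᵐ x ∂(volume.restrict (Ioo 0 L)), s x ≠ 0 := by
    filter_upwards [hEI] with x hx h
    rw [h] at hx
    simp at hx
  refine and_congr_right fun _ => forall_congr' fun c => ?_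
  rw [eigenspace_map_deflection hL hs hEI,
    (Submodule.equivMapOfInjective _ (deflection_injective hL hs h0) _).rank_eq]

/-- The indicators of the disjoint intervals `(L/(n+2), L/(n+1)]` are nonzero and mutually
orthogonal. -/
lemma infinite_dimensional_L2 (hL : 0 < L) : ¬ FiniteDimensional ℝ (L2 L) := by
  intro hfd
  have hone : IsBoundedWeight (fun _ => (1 : ℝ)) := ⟨measurable_const, 1, zero_le_one, by simp⟩
  let a : ℕ → ℝ := fun n => L / (n + 1)
  have ha : ∀ n, 0 < a n := fun n => by positivity
  have hanti : ∀ {m n}, m ≤ n → a n ≤ a m := fun {m n} h => by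
    refine div_le_div_of_nonneg_left hL.le (by positivity) ?_
    exact_mod_cast Nat.succ_le_succ h
  have hlt : ∀ n, a (n + 1) < a n := fun n =>
    div_lt_div_of_pos_left hL (by positivity) (by push_cast; linarith)
  let v : ℕ → L2 L := fun n => kernel hone (measurableSet_Ioc (a := a (n + 1)) (b := a n))
  have haL : ∀ n, a n ≤ L := fun n => by
    have := hanti (Nat.zero_le n)
    simpa [a] using this
  have hval : ∀ m n, ⟪v m, v n⟫_ℝ =
      ∫ x in Ioc (a (m + 1)) (a m), (Ioc (a (n + 1)) (a n)).indicator (fun _ => (1 : ℝ)) x := by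
    intro m n
    rw [inner_kernel, ← restrict_Ioo_eq_restrict_Ioc]
    have hsub : Ioo (a (m + 1)) (a m) ⊆ Ioo 0 L := Ioo_subset_Ioo (ha _).le (haL m)
    refine integral_congr_ae ?_
    filter_upwards [ae_restrict_of_ae_restrict_of_subset hsub (weighted_ae_eq (fun _ => (1 : ℝ)) (v n)),
      ae_restrict_of_ae_restrict_of_subset hsub
        (toL2_ae_eq (hone.memL2_indicator (measurableSet_Ioc (a := a (n + 1)) (b := a n))))]
      with x e1 e2
    rw [e1, mul_one]
    exact e2
  have hne : ∀ n, v n ≠ 0 := by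
    intro n h
    have := hval n n
    rw [h, inner_zero_left, setIntegral_indicator measurableSet_Ioc, inter_self] at this
    simp [Measure.real] at this
    have h1 := hlt n
    rw [ENNReal.toReal_ofReal (by linarith)] at this
    linarith
  have horth : ∀ m n, m < n → ⟪v m, v n⟫_ℝ = 0 := by
    intro m n hmn
    rw [hval]
    refine setIntegral_eq_zero_of_forall_eq_zero fun x hx => ?_
    refine indicator_of_notMem (fun hx' => ?_) _
    have := hanti (Nat.succ_le_of_lt hmn)
    exact absurd (hx.1.trans_le hx'.2) (not_lt.mpr this)
  have hli : LinearIndependent ℝ v := by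
    refine linearIndependent_of_ne_zero_of_inner_eq_zero hne fun m n hmn => ?_
    rcases lt_or_gt_of_ne hmn with h | h
    · exact horth m n h
    · change ⟪v m, v n⟫_ℝ = 0
      rw [real_inner_comm]; exact horth n m h
  exact not_finite_iff_infinite.mpr inferInstance hli.finite_of_isNoetherian

lemma infinite_dimensional_clamped (hL : 0 < L) (hs : IsBoundedWeight s) :
    ¬ FiniteDimensional ℝ (clamped L hs) := by
  intro hfd
  -- The clamped subspace is the kernel of a map to a plane, so its codimension is at most two.
  let f : L2 L →ₗ[ℝ] ℝ × ℝ :=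
    (LinearMap.proj L ∘ₗ primitive hs).prod (LinearMap.proj L ∘ₗ secondPrimitive hs)
  have hker : LinearMap.ker f = clamped L hs := by
    rw [LinearMap.ker_prod]; rfl
  have h1 : FiniteDimensional ℝ (LinearMap.ker f) := by rw [hker]; exact hfd
  have : FiniteDimensional ℝ (L2 L) := by
    have := Module.Finite.equiv f.quotKerEquivRange.symm
    exact Module.Finite.of_submodule_quotient (LinearMap.ker f)
  exact infinite_dimensional_L2 hL this

end Representation

/-! ### Partitions indexed by natural numbers, and step functions on them. -/

section Mesh

variable {L : ℝ} {N : ℕ}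

/-- The nodes of a partition as a sequence that is constant from the last node on. -/
def Partition.seq (x : Partition L N) (j : ℕ) : ℝ := x.node ⟨min j N, by omega⟩

lemma Partition.seq_castSucc (x : Partition L N) (k : Fin N) : x.seq k = x.node k.castSucc := by
  unfold seq; congr 1; ext; simp [k.2.le]

lemma Partition.seq_succ (x : Partition L N) (k : Fin N) : x.seq (k + 1) = x.node k.succ := by
  unfold seq; congr 1; ext; simp

lemma Partition.seq_zero (x : Partition L N) : x.seq 0 = 0 := by
  rw [← x.node_zero]; unfold seq; congr 1

lemma Partition.seq_last (x : Partition L N) : x.seq N = L := by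
  conv_rhs => rw [← x.node_last]
  unfold seq; congr 1; ext; simp

lemma Partition.seq_lt_succ (x : Partition L N) {k : ℕ} (hk : k < N) : x.seq k < x.seq (k + 1) := by
  have h := x.strictMono (Fin.castSucc_lt_succ (i := ⟨k, hk⟩))
  rwa [← x.seq_castSucc, ← x.seq_succ] at h

lemma Partition.seq_mono (x : Partition L N) : Monotone x.seq := by
  intro i j h
  refine x.strictMono.monotone ?_
  simp only [Fin.mk_le_mk]
  omega

lemma Partition.seq_mem (x : Partition L N) (j : ℕ) : x.seq j ∈ Icc 0 L := by
  have h0 := x.strictMono.monotone (Fin.zero_le ⟨min j N, by omega⟩)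
  have h1 := x.strictMono.monotone (Fin.le_last ⟨min j N, by omega⟩)
  rw [x.node_zero] at h0
  rw [x.node_last] at h1
  exact ⟨h0, h1⟩

lemma Partition.exists_mem_Icc (x : Partition L N) {t : ℝ} (ht : t ∈ Ioc 0 L) :
    ∃ k < N, t ∈ Icc (x.seq k) (x.seq (k + 1)) := by
  have key : ∀ n ≤ N, t ≤ x.seq n → ∃ k < N, t ∈ Icc (x.seq k) (x.seq (k + 1)) := by
    intro n
    induction n with
    | zero => intro _ h; rw [x.seq_zero] at h; exact absurd ht.1 (not_lt.mpr h)
    | succ n ih =>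
      intro hn h
      rcases le_total t (x.seq n) with h1 | h1
      · exact ih (by omega) h1
      · exact ⟨n, by omega, h1, h⟩
  exact key N le_rfl (by rw [x.seq_last]; exact ht.2)

lemma Partition.ae_exists_mem_Ioo (x : Partition L N) :
    ∀ᵐ t ∂(volume.restrict (Ioo 0 L)), ∃ k < N, t ∈ Ioo (x.seq k) (x.seq (k + 1)) := by
  rw [ae_restrict_iff' measurableSet_Ioo]
  have hnull : ∀ᵐ t : ℝ, t ∉ range x.node :=
    (Set.finite_range x.node).countable.ae_notMem volume
  filter_upwards [hnull] with t ht htm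
  obtain ⟨k, hk, h1, h2⟩ := x.exists_mem_Icc (Ioo_subset_Ioc_self htm)
  exact ⟨k, hk, lt_of_le_of_ne h1 fun h => ht ⟨_, h⟩, lt_of_le_of_ne h2 fun h => ht ⟨_, h.symm⟩⟩

lemma Partition.sum_integral (x : Partition L N) (hL : 0 < L) {f : ℝ → ℝ}
    (hf : IntegrableOn f (Ioo 0 L)) :
    ∑ k ∈ Finset.range N, ∫ t in (x.seq k)..(x.seq (k + 1)), f t = ∫ t in Ioo 0 L, f t := by
  have hi : IntervalIntegrable f volume 0 L :=
    (intervalIntegrable_iff_integrableOn_Ioo_of_le hL.le).mpr hf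
  rw [intervalIntegral.sum_integral_adjacent_intervals, x.seq_zero, x.seq_last,
    intervalIntegral.integral_of_le hL.le, integral_Ioc_eq_integral_Ioo]
  intro k _
  refine hi.mono_set ?_
  rw [uIcc_of_le (x.seq_mono (Nat.le_succ k)), uIcc_of_le hL.le]
  exact Icc_subset_Icc (x.seq_mem k).1 (x.seq_mem _).2

lemma Partition.Ioo_subset (x : Partition L N) (k : ℕ) :
    Ioo (x.seq k) (x.seq (k + 1)) ⊆ Ioo 0 L :=
  Ioo_subset_Ioo (x.seq_mem k).1 (x.seq_mem _).2

/-- The step function with value `c k` on the `k`-th element. -/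
def stepFun (x : Partition L N) (c : ℕ → ℝ) (t : ℝ) : ℝ :=
  ∑ k ∈ Finset.range N, (Ioo (x.seq k) (x.seq (k + 1))).indicator (fun _ => c k) t

lemma stepFun_of_mem (x : Partition L N) (c : ℕ → ℝ) {k : ℕ} (hk : k < N) {t : ℝ}
    (ht : t ∈ Ioo (x.seq k) (x.seq (k + 1))) : stepFun x c t = c k := by
  rw [stepFun, Finset.sum_eq_single k, indicator_of_mem ht]
  · intro j _ hj
    refine indicator_of_notMem (fun h => ?_) _
    rcases lt_or_gt_of_ne hj with h' | h'
    · exact absurd (ht.1.trans h.2) (not_lt.mpr (x.seq_mono h'))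
    · exact absurd (h.1.trans ht.2) (not_lt.mpr (x.seq_mono h'))
  · intro h; exact absurd (Finset.mem_range.mpr hk) h

lemma isBoundedWeight_stepFun (x : Partition L N) (c : ℕ → ℝ) :
    IsBoundedWeight (stepFun x c) := by
  refine ⟨Finset.measurable_fun_sum _ fun k _ => measurable_const.indicator measurableSet_Ioo,
    ∑ k ∈ Finset.range N, |c k|, Finset.sum_nonneg fun _ _ => abs_nonneg _, fun t => ?_⟩
  refine (Finset.abs_sum_le_sum_abs _ _).trans (Finset.sum_le_sum fun k _ => ?_)
  exact norm_indicator_le_norm_self (fun _ => c k) t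

end Mesh

/-! ### Piecewise affine second derivatives, cubic elements, and the error estimate. -/

section FiniteElements

variable {L : ℝ} {N : ℕ}

/-- The monomials `1` and `t` on the `k`-th element. -/
def elementMonomial (x : Partition L N) (k p : ℕ) (t : ℝ) : ℝ :=
  (Ioo (x.seq k) (x.seq (k + 1))).indicator (fun t => t ^ p) t

lemma memL2_elementMonomial (x : Partition L N) (k p : ℕ) : MemL2 L (elementMonomial x k p) := by
  have h : MemL2 L (fun t : ℝ => t ^ p) := memL2_of_continuousOn (continuous_pow p).continuousOn
  exact MemLp.indicator measurableSet_Ioo h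

/-- The functions in `L²(0,L)` that are affine on every element. -/
def piecewiseAffine (x : Partition L N) : Submodule ℝ (L2 L) :=
  Submodule.span ℝ (range fun i : Fin N × Fin 2 => toL2 (memL2_elementMonomial x i.1 i.2))

instance (x : Partition L N) : FiniteDimensional ℝ (piecewiseAffine x) :=
  FiniteDimensional.span_of_finite ℝ (finite_range _)

lemma exists_affine_of_mem_piecewiseAffine (x : Partition L N) {l : L2 L}
    (hl : l ∈ piecewiseAffine x) (k : ℕ) :
    ∃ α β : ℝ, ∀ᵐ t ∂(volume.restrict (Ioo (x.seq k) (x.seq (k + 1)))), l t = α + β * t := by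
  have hmono : ∀ {p : ℝ → Prop}, (∀ᵐ t ∂(volume.restrict (Ioo 0 L)), p t) →
      ∀ᵐ t ∂(volume.restrict (Ioo (x.seq k) (x.seq (k + 1)))), p t :=
    fun h => ae_restrict_of_ae_restrict_of_subset (x.Ioo_subset k) h
  induction hl using Submodule.span_induction with
  | mem l hl =>
    obtain ⟨⟨j, p⟩, rfl⟩ := hl
    have h1 := hmono (toL2_ae_eq (memL2_elementMonomial x j p))
    by_cases hjk : (j : ℕ) = k
    · have h2 : ∀ᵐ t ∂(volume.restrict (Ioo (x.seq k) (x.seq (k + 1)))),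
          toL2 (memL2_elementMonomial x j p) t = t ^ (p : ℕ) := by
        filter_upwards [h1, ae_restrict_mem measurableSet_Ioo] with t ht htm
        rw [ht, elementMonomial, hjk, indicator_of_mem htm]
      fin_cases p
      · exact ⟨1, 0, h2.mono fun t ht => by simpa using ht⟩
      · exact ⟨0, 1, h2.mono fun t ht => by simpa using ht⟩
    · refine ⟨0, 0, ?_⟩
      filter_upwards [h1, ae_restrict_mem measurableSet_Ioo] with t ht htm
      rw [ht, elementMonomial, indicator_of_notMem]
      · simp
      · intro h
        rcases lt_or_gt_of_ne hjk with h' | h'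
        · exact absurd (htm.1.trans h.2) (not_lt.mpr (x.seq_mono h'))
        · exact absurd (h.1.trans htm.2) (not_lt.mpr (x.seq_mono h'))
  | zero =>
    refine ⟨0, 0, ?_⟩
    filter_upwards [hmono (Lp.coeFn_zero ℝ 2 (volume.restrict (Ioo 0 L)))] with t ht
    rw [ht]; simp
  | add l₁ l₂ _ _ h₁ h₂ =>
    obtain ⟨α₁, β₁, h₁⟩ := h₁
    obtain ⟨α₂, β₂, h₂⟩ := h₂
    refine ⟨α₁ + α₂, β₁ + β₂, ?_⟩
    filter_upwards [hmono (Lp.coeFn_add l₁ l₂), h₁, h₂] with t ht e₁ e₂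
    rw [ht, Pi.add_apply, e₁, e₂]; ring
  | smul r l _ h =>
    obtain ⟨α, β, h⟩ := h
    refine ⟨r * α, r * β, ?_⟩
    filter_upwards [hmono (Lp.coeFn_smul r l), h] with t ht e
    rw [ht, Pi.smul_apply, e, smul_eq_mul]; ring

variable (x : Partition L N) (c : ℕ → ℝ)

lemma weighted_stepFun_ae (g : L2 L) {k : ℕ} (hk : k < N) :
    ∀ t ∈ Ioo (x.seq k) (x.seq (k + 1)), weighted (stepFun x c) g t = c k * g t := by
  intro t ht
  rw [weighted, indicator_of_mem (x.Ioo_subset k ht), stepFun_of_mem x c hk ht, mul_comm]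

lemma primitive_add (hs : IsBoundedWeight (stepFun x c)) (g : L2 L) (a t : ℝ) :
    primitive hs g t = primitive hs g a + ∫ τ in a..t, weighted (stepFun x c) g τ := by
  rw [primitive_apply, primitive_apply, intervalIntegral.integral_add_adjacent_intervals
    (integrable_weighted hs g).intervalIntegrable (integrable_weighted hs g).intervalIntegrable]

lemma secondPrimitive_add (hs : IsBoundedWeight (stepFun x c)) (g : L2 L) (a t : ℝ) :
    secondPrimitive hs g t = secondPrimitive hs g a + ∫ τ in a..t, primitive hs g τ := by
  rw [secondPrimitive_apply, secondPrimitive_apply,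
    intervalIntegral.integral_add_adjacent_intervals
    ((continuous_primitive hs g).intervalIntegrable _ _)
    ((continuous_primitive hs g).intervalIntegrable _ _)]

/-- The weight is constant on an element, so integrating an affine function twice yields a cubic
there; its coefficients are written out. -/
lemma deflection_mem_Vh (hL : 0 < L) (hs : IsBoundedWeight (stepFun x c)) {l : L2 L}
    (hl : l ∈ piecewiseAffine x) (hl' : l ∈ clamped L hs) : deflection hs l ∈ Vh x := by
  refine ⟨deflection_mem_V hL hs hl', fun k => ?_⟩
  rw [← x.seq_castSucc, ← x.seq_succ]
  obtain ⟨α, β, h⟩ := exists_affine_of_mem_piecewiseAffine x hl k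
  set a := x.seq k
  set b := x.seq (k + 1)
  set A := primitive hs l a with hA
  have h1 : ∀ t ∈ Icc a b,
      primitive hs l t = A + c k * (α * (t - a) + β * ((t ^ 2 - a ^ 2) / 2)) := by
    intro t ht
    rw [primitive_add x c hs l a t, ← hA]
    congr 1
    have e : ∫ τ in a..t, weighted (stepFun x c) l τ = ∫ τ in a..t, c k * (α + β * τ) := by
      refine intervalIntegral.integral_congr_ae_restrict ?_
      rw [uIoc_of_le ht.1, ← restrict_Ioo_eq_restrict_Ioc]
      filter_upwards [ae_restrict_of_ae_restrict_of_subset (Ioo_subset_Ioo_right ht.2) h,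
        ae_restrict_mem measurableSet_Ioo] with τ hτ hτm
      rw [weighted_stepFun_ae x c l k.2 τ (Ioo_subset_Ioo_right ht.2 hτm), hτ]
    rw [e, intervalIntegral.integral_const_mul, intervalIntegral.integral_add
      (continuous_const.intervalIntegrable _ _) (Continuous.intervalIntegrable (by fun_prop) _ _),
      intervalIntegral.integral_const_mul, integral_id, intervalIntegral.integral_const, smul_eq_mul]
    ring
  set D := secondPrimitive hs l a with hD
  have h2 : ∀ t ∈ Icc a b, secondPrimitive hs l t =
      D + ((A - c k * (α * a + β * (a ^ 2 / 2))) * (t - a) + c k * α * ((t ^ 2 - a ^ 2) / 2) +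
        c k * β / 2 * ((t ^ 3 - a ^ 3) / 3)) := by
    intro t ht
    rw [secondPrimitive_add x c hs l a t, ← hD]
    congr 1
    have e : ∫ τ in a..t, primitive hs l τ = ∫ τ in a..t,
        ((A - c k * (α * a + β * (a ^ 2 / 2))) + c k * α * τ + c k * β / 2 * τ ^ 2) := by
      refine intervalIntegral.integral_congr fun τ hτ => ?_
      rw [uIcc_of_le ht.1] at hτ
      simp only [h1 τ ⟨hτ.1, hτ.2.trans ht.2⟩]
      ring
    rw [e, intervalIntegral.integral_add (Continuous.intervalIntegrable (by fun_prop) _ _)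
      (Continuous.intervalIntegrable (by fun_prop) _ _), intervalIntegral.integral_add
      (Continuous.intervalIntegrable (by fun_prop) _ _)
      (Continuous.intervalIntegrable (by fun_prop) _ _), intervalIntegral.integral_const_mul,
      intervalIntegral.integral_const_mul, integral_id, integral_pow,
      intervalIntegral.integral_const, smul_eq_mul]
    norm_num
    ring
  refine ⟨Polynomial.C (D - (A - c k * (α * a + β * (a ^ 2 / 2))) * a - c k * α * (a ^ 2 / 2) -
      c k * β / 2 * (a ^ 3 / 3)) + Polynomial.C (A - c k * (α * a + β * (a ^ 2 / 2))) * Polynomial.X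
      + Polynomial.C (c k * α / 2) * Polynomial.X ^ 2 +
      Polynomial.C (c k * β / 6) * Polynomial.X ^ 3, by compute_degree, fun t ht => ?_⟩
  rw [deflection_of_mem hs l ⟨(x.seq_mem k).1.trans ht.1, ht.2.trans (x.seq_mem _).2⟩, h2 t ht]
  simp only [Polynomial.eval_add, Polynomial.eval_mul, Polynomial.eval_C, Polynomial.eval_X,
    Polynomial.eval_pow]
  ring

/-- A cubic is determined by its values at four points, so evaluation at four equidistant points of
every element is injective. -/
lemma finiteDimensional_Vh : FiniteDimensional ℝ (Vh x) := by
  let pt : Fin N → Fin 4 → ℝ := fun k j => x.seq k + (j : ℝ) * ((x.seq (k + 1) - x.seq k) / 3)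
  let f : Vh x →ₗ[ℝ] (Fin N → Fin 4 → ℝ) :=
    LinearMap.pi fun k => LinearMap.pi fun j => LinearMap.proj (pt k j) ∘ₗ (Vh x).subtype
  refine FiniteDimensional.of_injective f ?_
  rw [← LinearMap.ker_eq_bot, LinearMap.ker_eq_bot']
  rintro ⟨v, hv⟩ h
  obtain ⟨⟨-, -, hout, hv0, -⟩, hpoly⟩ := id hv
  refine Subtype.ext (funext fun t => ?_)
  change v t = 0
  by_cases ht : t ∈ Icc 0 L
  swap
  · exact hout t ht
  rcases eq_or_lt_of_le ht.1 with h0 | h0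
  · rw [← h0, hv0]
  obtain ⟨k, hk, htk⟩ := x.exists_mem_Icc ⟨h0, ht.2⟩
  obtain ⟨p, hp, hpe⟩ := hpoly ⟨k, hk⟩
  rw [← x.seq_castSucc, ← x.seq_succ] at hpe
  have hlt := x.seq_lt_succ hk
  have hp0 : p = 0 := by
    refine Polynomial.eq_zero_of_natDegree_lt_card_of_eval_eq_zero p (ι := Fin 4)
      (f := pt ⟨k, hk⟩) ?_ (fun j => ?_) (by simpa using Nat.lt_succ_of_le hp)
    · intro i j hij
      have hpos : 0 < (x.seq (k + 1) - x.seq k) / 3 := by linarith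
      have : (i : ℝ) = j := mul_right_cancel₀ hpos.ne' (add_left_cancel hij)
      exact Fin.ext (by exact_mod_cast this)
    · have hj : ((j : ℕ) : ℝ) ≤ 3 := by exact_mod_cast Nat.lt_succ_iff.mp j.2
      have hj0 : (0 : ℝ) ≤ (j : ℕ) := Nat.cast_nonneg _
      rw [← hpe]
      · exact congr_fun (congr_fun h ⟨k, hk⟩) j
      · constructor
        · simp only [pt]; nlinarith
        · simp only [pt]; nlinarith
  rw [hpe t htk, hp0, Polynomial.eval_zero]

lemma integral_weighted_pow_eq_zero {w : L2 L} (hw : w ∈ (piecewiseAffine x)ᗮ) {k p : ℕ}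
    (hk : k < N) (hp : p < 2) :
    ∫ t in (x.seq k)..(x.seq (k + 1)), weighted (stepFun x c) w t * t ^ p = 0 := by
  have h := hw _ (Submodule.subset_span ⟨⟨⟨k, hk⟩, ⟨p, hp⟩⟩, rfl⟩)
  rw [L2.inner_def] at h
  have e : ∫ t in Ioo 0 L, ⟪toL2 (memL2_elementMonomial x k p) t, w t⟫_ℝ =
      ∫ t in Ioo (x.seq k) (x.seq (k + 1)), w t * t ^ p := by
    rw [← inter_eq_self_of_subset_right (x.Ioo_subset k), ← setIntegral_indicator measurableSet_Ioo]
    refine integral_congr_ae ?_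
    filter_upwards [toL2_ae_eq (memL2_elementMonomial x k p)] with t ht
    rw [ht, elementMonomial]
    by_cases hm : t ∈ Ioo (x.seq k) (x.seq (k + 1)) <;> simp [hm]
  rw [intervalIntegral.integral_of_le (x.seq_mono (Nat.le_succ k)), integral_Ioc_eq_integral_Ioo]
  have e2 : ∫ t in Ioo (x.seq k) (x.seq (k + 1)), weighted (stepFun x c) w t * t ^ p =
      ∫ t in Ioo (x.seq k) (x.seq (k + 1)), c k * (w t * t ^ p) := by
    refine setIntegral_congr_fun measurableSet_Ioo fun t ht => ?_
    simp only [weighted_stepFun_ae x c w hk t ht]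
    ring
  rw [e2, integral_const_mul, ← e]
  simp only at h
  rw [h, mul_zero]

/-- Induction from node to node. The vanishing moment of order zero carries the zero of the first
primitive across an element; integrating that primitive by parts against `t` then uses the moment of
order one for the second primitive. -/
lemma primitives_eq_zero_of_mem_orthogonal (hs : IsBoundedWeight (stepFun x c)) {w : L2 L}
    (hw : w ∈ (piecewiseAffine x)ᗮ) {k : ℕ} (hk : k ≤ N) :
    primitive hs w (x.seq k) = 0 ∧ secondPrimitive hs w (x.seq k) = 0 := by
  induction k with
  | zero => rw [x.seq_zero]; simp [primitive_apply, secondPrimitive_apply]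
  | succ k ih =>
    obtain ⟨h1, h2⟩ := ih (by omega)
    have m0 := integral_weighted_pow_eq_zero x c hw (k := k) (p := 0) (by omega) (by omega)
    have m1 := integral_weighted_pow_eq_zero x c hw (k := k) (p := 1) (by omega) (by omega)
    simp only [pow_zero, mul_one, pow_one] at m0 m1
    have h3 : primitive hs w (x.seq (k + 1)) = 0 := by
      rw [primitive_add x c hs w (x.seq k), h1, m0, zero_add]
    refine ⟨h3, ?_⟩
    have ibp := integral_primitive_mul_deriv (C := 0) (x.seq_mono (Nat.le_succ k))
      (f := weighted (stepFun x c) w) (F := primitive hs w) (φ := fun t => t)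
      (integrable_weighted hs w).intervalIntegrable
      (fun t _ => by rw [primitive_add x c hs w (x.seq k), h1]) contDiff_id
    have hd : deriv (fun t : ℝ => t) = fun _ => 1 := deriv_id'
    simp only [hd, mul_one] at ibp
    rw [Nat.succ_eq_add_one, h3, h1, m1] at ibp
    rw [secondPrimitive_add x c hs w (x.seq k), h2, ibp]
    simp

/-- On each element the first primitive vanishes at both ends and has mean zero, since the second
primitive vanishes at both ends too. So `wirtinger` applies elementwise, and the estimates are
summed. -/
lemma norm_slope_le_of_mem_orthogonal (hL : 0 < L) (hs : IsBoundedWeight (stepFun x c)) {C : ℝ}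
    (hC : 0 ≤ C)
    (hcC : ∀ k < N, ((x.seq (k + 1) - x.seq k) / (2 * Real.pi)) ^ 2 * c k ^ 2 ≤ C ^ 2) {w : L2 L}
    (hw : w ∈ (piecewiseAffine x)ᗮ) : ‖slope hL hs w‖ ≤ C * ‖w‖ := by
  have hsq : MemL2 L (primitive hs w) := memL2_primitive hs w
  have e1 : ‖slope hL hs w‖ ^ 2 = ∫ t in Ioo 0 L, primitive hs w t ^ 2 := by
    rw [← real_inner_self_eq_norm_sq, L2.inner_def]
    refine integral_congr_ae ?_
    filter_upwards [slope_ae_eq hL hs w] with t ht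
    simp [ht, sq]
  have e2 : ‖w‖ ^ 2 = ∫ t in Ioo 0 L, w t ^ 2 := by
    rw [← real_inner_self_eq_norm_sq, L2.inner_def]
    simp [sq]
  have hmain : ‖slope hL hs w‖ ^ 2 ≤ C ^ 2 * ‖w‖ ^ 2 := by
    rw [e1, e2, ← x.sum_integral hL (MemLp.integrable_sq hsq),
      ← x.sum_integral hL (MemLp.integrable_sq (memL2_coeFn w)), Finset.mul_sum]
    refine Finset.sum_le_sum fun k hk => ?_
    have hk : k < N := Finset.mem_range.mp hk
    obtain ⟨h1, h2⟩ := primitives_eq_zero_of_mem_orthogonal x c hs hw hk.le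
    obtain ⟨h3, h4⟩ := primitives_eq_zero_of_mem_orthogonal x c hs hw (Nat.succ_le_of_lt hk)
    have hlt := x.seq_lt_succ hk
    have hwm : MemLp (weighted (stepFun x c) w) 2
        (volume.restrict (Ioc (x.seq k) (x.seq (k + 1)))) := by
      rw [← restrict_Ioo_eq_restrict_Ioc]
      exact MemLp.mono_measure (Measure.restrict_mono (x.Ioo_subset k) le_rfl)
        (memL2_weighted hs w)
    have hmean : ∫ t in (x.seq k)..(x.seq (k + 1)), primitive hs w t = 0 := by
      have := secondPrimitive_add x c hs w (x.seq k) (x.seq (k + 1))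
      rw [h2] at this
      have h4' : secondPrimitive hs w (x.seq (k + 1)) = 0 := h4
      linarith
    have hW := wirtinger hlt hwm
      (fun t _ => by rw [primitive_add x c hs w (x.seq k), h1, zero_add]) h3 hmean
    have e3 : ∫ t in (x.seq k)..(x.seq (k + 1)), weighted (stepFun x c) w t ^ 2 =
        c k ^ 2 * ∫ t in (x.seq k)..(x.seq (k + 1)), w t ^ 2 := by
      rw [intervalIntegral.integral_of_le hlt.le, intervalIntegral.integral_of_le hlt.le,
        integral_Ioc_eq_integral_Ioo, integral_Ioc_eq_integral_Ioo, ← integral_const_mul]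
      refine setIntegral_congr_fun measurableSet_Ioo fun t ht => ?_
      simp only [weighted_stepFun_ae x c w hk t ht]
      ring
    rw [e3, ← mul_assoc] at hW
    refine hW.trans (mul_le_mul_of_nonneg_right (hcC k hk) ?_)
    exact intervalIntegral.integral_nonneg hlt.le fun t _ => sq_nonneg _
  rw [← mul_pow] at hmain
  exact le_of_pow_le_pow_left₀ two_ne_zero (by positivity) hmain

end FiniteElements

/-! ### Alignment of the mesh with the stiffness, and the constant `C_h`. -/

section Main

variable {L : ℝ} {N : ℕ}

/-- The midpoint of the element lies in some stiffness segment, whose ends are mesh nodes and so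
cannot be interior to the element. The condition `k < N` sits inside the existential so that the
constants can be chosen as a sequence on `ℕ`. -/
lemma exists_const_on_elements {r : ℕ} (y : Partition L r) {EI : ℝ → ℝ}
    (hEI : IsPiecewiseConstant y EI) (x : Partition L N) (hxy : IsAligned x y) (k : ℕ) :
    ∃ c : ℝ, k < N → 0 < c ∧ ∀ t ∈ Ioo (x.seq k) (x.seq (k + 1)), EI t = c := by
  by_cases hk : k < N
  swap
  · exact ⟨0, fun h => absurd h hk⟩
  have hlt := x.seq_lt_succ hk
  set m := (x.seq k + x.seq (k + 1)) / 2 with hm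
  have h1 : x.seq k < m := by rw [hm]; linarith
  have h2 : m < x.seq (k + 1) := by rw [hm]; linarith
  obtain ⟨j, hj, hmj⟩ := y.exists_mem_Icc
    ⟨(x.seq_mem k).1.trans_lt h1, h2.le.trans (x.seq_mem (k + 1)).2⟩
  obtain ⟨c, hc, hcE⟩ := hEI ⟨j, hj⟩
  have hnode : ∀ i : Fin (N + 1), x.node i ≤ x.seq k ∨ x.seq (k + 1) ≤ x.node i := by
    intro i
    have hi : x.node i = x.seq i := by
      unfold Partition.seq; congr 1; ext; simp; omega
    rw [hi]
    rcases le_or_gt (i : ℕ) k with h | h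
    · exact Or.inl (x.seq_mono h)
    · exact Or.inr (x.seq_mono h)
  rw [← y.seq_castSucc, ← y.seq_succ] at hcE
  have hlow : y.seq j ≤ x.seq k := by
    obtain ⟨i, hi⟩ := hxy (Fin.castSucc ⟨j, hj⟩)
    have e := y.seq_castSucc ⟨j, hj⟩
    rw [hi] at e
    rw [show y.seq j = x.node i from e]
    refine (hnode i).resolve_right fun h => ?_
    rw [← show y.seq j = x.node i from e] at h
    linarith [hmj.1]
  have hupp : x.seq (k + 1) ≤ y.seq (j + 1) := by
    obtain ⟨i, hi⟩ := hxy (Fin.succ ⟨j, hj⟩)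
    have e := y.seq_succ ⟨j, hj⟩
    rw [hi] at e
    rw [show y.seq (j + 1) = x.node i from e]
    refine (hnode i).resolve_left fun h => ?_
    rw [← show y.seq (j + 1) = x.node i from e] at h
    linarith [hmj.2]
  exact ⟨c, fun _ => ⟨hc, fun t ht => hcE t (Ioo_subset_Ioo hlow hupp ht)⟩⟩

lemma div_le_Ch_sq (x : Partition L N) {EI : ℝ → ℝ} {c : ℕ → ℝ}
    (hc : ∀ k < N, 0 < c k ∧ ∀ t ∈ Ioo (x.seq k) (x.seq (k + 1)), EI t = c k) {k : ℕ}
    (hk : k < N) :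
    ((x.seq (k + 1) - x.seq k) / (2 * Real.pi)) ^ 2 * (√(c k))⁻¹ ^ 2 ≤ Ch x EI ^ 2 := by
  have hkappa : ∀ j : Fin N, kappa x EI j = c j := by
    intro j
    have hlt := x.seq_lt_succ j.2
    rw [kappa, ← x.seq_castSucc, ← x.seq_succ]
    have : EI '' Ioo (x.seq j) (x.seq (j + 1)) = {c j} := by
      rw [← (nonempty_Ioo.mpr hlt).image_const]
      exact image_congr fun t ht => (hc j j.2).2 t ht
    rw [this, csInf_singleton]
  have hlen : ∀ j : Fin N, x.len j = x.seq (j + 1) - x.seq j := by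
    intro j
    rw [Partition.len, ← x.seq_castSucc, ← x.seq_succ]
  have h0 : ∀ j : Fin N, 0 ≤ x.len j ^ 2 / kappa x EI j := fun j => by
    rw [hkappa]; exact div_nonneg (sq_nonneg _) (hc j j.2).1.le
  have hle : x.len ⟨k, hk⟩ ^ 2 / kappa x EI ⟨k, hk⟩ ≤ ⨆ j : Fin N, x.len j ^ 2 / kappa x EI j :=
    le_ciSup (f := fun j : Fin N => x.len j ^ 2 / kappa x EI j) (Set.finite_range _).bddAbove
      ⟨k, hk⟩
  rw [hkappa, hlen] at hle
  rw [Ch, hEI, div_pow, div_pow, Real.sq_sqrt (Real.iSup_nonneg h0), inv_pow,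
    Real.sq_sqrt (hc k hk).1.le, div_mul_eq_mul_div, ← div_eq_mul_inv]
  exact div_le_div_of_nonneg_right hle (by positivity)

end Main

end BeamBuckling

end

theorem mainTheorem2 (L : ℝ) (hL : 0 < L) (EI : ℝ → ℝ)
    (r : ℕ) (y : BeamBuckling.Partition L r) (hEI : BeamBuckling.IsPiecewiseConstant y EI)
    (N : ℕ) (x : BeamBuckling.Partition L N) (hxy : BeamBuckling.IsAligned x y) :
    -- both eigenvalue problems possess their sequences of eigenvalues
    (∃ P : ℕ → ℝ, BeamBuckling.IsEigenvalueEnumeration L EI (BeamBuckling.V L) P) ∧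
    (∃ Ph : Fin (Module.finrank ℝ (BeamBuckling.Vh x)) → ℝ,
      BeamBuckling.IsEigenvalueEnumeration L EI (BeamBuckling.Vh x) Ph) ∧
    -- and these satisfy the two-sided bound
    ∀ (P : ℕ → ℝ) (Ph : Fin (Module.finrank ℝ (BeamBuckling.Vh x)) → ℝ),
      BeamBuckling.IsEigenvalueEnumeration L EI (BeamBuckling.V L) P →
      BeamBuckling.IsEigenvalueEnumeration L EI (BeamBuckling.Vh x) Ph →
      ∀ i : Fin (Module.finrank ℝ (BeamBuckling.Vh x)),
        Ph i / (1 + Ph i * BeamBuckling.Ch x EI ^ 2) ≤ P i ∧ P i ≤ Ph i := by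
  open BeamBuckling in
  choose c hc using exists_const_on_elements y hEI x hxy
  have hs := isBoundedWeight_stepFun x fun k => (√(c k))⁻¹
  -- Built from the mesh instead of from `EI`, this version of `EI^(-1/2)` is bounded and measurable
  -- whatever `EI` does at the nodes and outside the interval.
  set s := stepFun x fun k => (√(c k))⁻¹ with hsdef
  have hval : ∀ᵐ t ∂(volume.restrict (Ioo 0 L)),
      ∃ k < N, s t = (√(c k))⁻¹ ∧ EI t = c k := by
    filter_upwards [x.ae_exists_mem_Ioo] with t ⟨k, hk, ht⟩
    exact ⟨k, hk, stepFun_of_mem x _ hk ht, (hc k hk).2 t ht⟩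
  have hEIs : ∀ᵐ t ∂(volume.restrict (Ioo 0 L)), EI t * s t ^ 2 = 1 := by
    filter_upwards [hval] with t ⟨k, hk, h1, h2⟩
    rw [h1, h2, inv_pow, Real.sq_sqrt (hc k hk).1.le, mul_inv_cancel₀ (hc k hk).1.ne']
  have hinv : ∃ B, ∀ᵐ t ∂(volume.restrict (Ioo 0 L)), s t ≠ 0 ∧ |(s t)⁻¹| ≤ B := by
    refine ⟨∑ k ∈ Finset.range N, √(c k), ?_⟩
    filter_upwards [hval] with t ⟨k, hk, h1, h2⟩
    have hpos : 0 < √(c k) := Real.sqrt_pos.mpr (hc k hk).1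
    rw [h1, inv_inv, abs_of_pos hpos]
    exact ⟨(inv_pos.mpr hpos).ne', Finset.single_le_sum (f := fun k => √(c k))
      (fun _ _ => Real.sqrt_nonneg _) (Finset.mem_range.mpr hk)⟩
  have h0 : ∀ᵐ t ∂(volume.restrict (Ioo 0 L)), s t ≠ 0 := hinv.choose_spec.mono fun _ h => h.1
  have hinj := deflection_injective hL hs h0
  have hJinj := slope_injective hL hs h0
  have hJ := isCompactOperator_slope hL hs
  have hV := map_clamped hL hs hinv
  have hVfd := finiteDimensional_Vh x
  set K := clamped L hs
  -- The discrete space is pulled back to `L²(0,L)`, so that both problems concern the same operator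
  -- on nested subspaces.
  set Kh := K ⊓ (Vh x).comap (deflection hs) with hKh
  have hVh : Kh.map (deflection hs) = Vh x := by
    ext u
    constructor
    · rintro ⟨g, hg, rfl⟩; exact hg.2
    · intro hu
      obtain ⟨g, hg, rfl⟩ : u ∈ K.map (deflection hs) := by rw [hV]; exact hu.1
      exact ⟨g, ⟨hg, hu⟩, rfl⟩
  have e : Kh ≃ₗ[ℝ] Vh x :=
    (Submodule.equivMapOfInjective _ hinj Kh).trans (LinearEquiv.ofEq _ _ hVh)
  have hKfd : FiniteDimensional ℝ Kh := Module.Finite.equiv e.symm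
  obtain ⟨Q, u, hQ⟩ := exists_isEigensystem_nat hJ hJinj K (isClosed_clamped hL hs)
    (infinite_dimensional_clamped hL hs)
  obtain ⟨Qh, uh, hQh⟩ := exists_isEigensystem_fin hJ hJinj Kh e.finrank_eq
  have iffV := fun P : ℕ → ℝ => isEigenvalueEnumeration_map_iff hL hs hEIs K P
  have iffVh := fun P : Fin (Module.finrank ℝ (Vh x)) → ℝ =>
    isEigenvalueEnumeration_map_iff hL hs hEIs Kh P
  rw [hV] at iffV
  rw [hVh] at iffVh
  refine ⟨⟨Q, (iffV Q).mpr ⟨hQ.mono, hQ.rank_eigSpace⟩⟩,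
    ⟨Qh, (iffVh Qh).mpr ⟨hQh.mono, hQh.rank_eigSpace⟩⟩, fun P Ph hP hPh i => ?_⟩
  obtain ⟨hP1, hP2⟩ := (iffV P).mp hP
  obtain ⟨hPh1, hPh2⟩ := (iffVh Ph).mp hPh
  have eP : P = Q := eq_of_monotone_of_card_fiber_eq hP1 hQ.mono fun t =>
    (hP2 t).trans (hQ.rank_eigSpace t).symm
  have ePh : Ph = Qh := eq_of_monotone_of_card_fiber_eq hPh1 hQh.mono fun t =>
    (hPh2 t).trans (hQh.rank_eigSpace t).symm
  subst eP ePh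
  refine eigenvalue_bounds hJinj inf_le_left hQ hQh (fun w hw hort => ?_) i
  refine norm_slope_le_of_mem_orthogonal x _ hL hs
    (div_nonneg (Real.sqrt_nonneg _) (by positivity)) (fun k hk => div_le_Ch_sq x hc hk) ?_
  -- At the last node, which is `L`, the vanishing primitives are exactly the clamping conditions.
  have hmem : ∀ v ∈ (piecewiseAffine x)ᗮ, v ∈ K := fun v hv => by
    have := primitives_eq_zero_of_mem_orthogonal x _ hs hv le_rfl
    rwa [x.seq_last] at this
  -- Since `w` and `w - l` are clamped, so is the piecewise affine `l`. Hence `l` belongs to `Kh`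
  -- and is orthogonal to `w` as well as to `w - l`, which forces `l = 0`.
  set l := (piecewiseAffine x).starProjection w
  have hl : l ∈ piecewiseAffine x := Submodule.starProjection_apply_mem _ w
  have hwl : w - l ∈ (piecewiseAffine x)ᗮ := Submodule.sub_starProjection_mem_orthogonal w
  have hlK : l ∈ K := by
    have := K.sub_mem hw (hmem _ hwl)
    rwa [sub_sub_cancel] at this
  have hlKh : l ∈ Kh := ⟨hlK, deflection_mem_Vh x _ hL hs hl hlK⟩
  have h1 := hort l hlKh
  have h2 := hwl l hl
  rw [inner_sub_right, h1, zero_sub, neg_eq_zero] at h2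
  rw [inner_self_eq_zero.mp h2, sub_zero] at hwl
  exact hwl
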